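/- Let $K\subset\mathbb{C}$ be an imaginary quadratic number field with discriminant $D_K$ whose ring of integers $\mathcal{O}_K$ is principal. For a nonzero ideal $\mathfrak{a}$ of $\mathcal{O}_K$ let $\varphi_K(\mathfrak{a})=\operatorname{Card}\big((\mathcal{O}_K/\mathfrak{a})^\times\big)$, and for $a\in\mathcal{O}_K\setminus\{0\}$ let $\varphi_K(a)=\varphi_K(a\mathcal{O}_K)$ and $\mathrm{N}(a)=\operatorname{Card}(\mathcal{O}_K/a\mathcal{O}_K)$; put $\mathrm{N}(0)=0$. For $z\in\mathbb{C}^\times$, $\theta\in\,]0,2\pi]$ and $x\ge 1$ let $$C(z,\theta,x)=\Big\{\rho e^{it}z : t\in\Big]-\frac{\theta}{2},\frac{\theta}{2}\Big],\ 0<\rho\le\frac{x}{|z|}\Big\}.$$ **Theorem 4.1.** There exists a universal constant $C>0$ (independent also of $K$) such that for all $k\in\mathcal{O}_K$ and all nonzero ideals $\mathfrak{m}$ of $\mathcal{O}_K$, there exists a constant $c_{\mathfrak{m},k}\in\,]0,1]$ such that for all $z\in\mathbb{C}^\times$, $\theta\in\,]0,2\pi]$ and $x\ge 1$, the set $\mathfrak{m}\cap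 C(z,\theta,x)$ is finite and $$\Bigg|\sum_{\substack{a\in\mathfrak{m}\cap C(z,\theta,x)\\ a\ne -k}}\varphi_K(a)\,\varphi_K(a+k)-\frac{\theta\,c_{\mathfrak{m},k}}{3\sqrt{|D_K|}}\,x^6\Bigg|\le C\Big(\big(1+\sqrt{\mathrm{N}(k)}\big)x^5+\mathrm{N}(k)\,x^4\Big).$$ -/

import Mathlib

/-- The Euler function of a number field `K` on ideals of its ring of integers:
the number of invertible elements of `𝓞 K ⧸ I` (it is used for nonzero `I` only). -/
noncomputable def idealEulerPhi {K : Type*} [Field K] [NumberField K]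
    (I : Ideal (NumberField.RingOfIntegers K)) : ℕ :=
  Nat.card (NumberField.RingOfIntegers K ⧸ I)ˣ

/-- The Euler function of `K` on (nonzero) algebraic integers: that of the principal ideal. -/
noncomputable def eulerPhi {K : Type*} [Field K] [NumberField K]
    (a : NumberField.RingOfIntegers K) : ℕ :=
  idealEulerPhi (Ideal.span {a})

/-- The absolute norm of an algebraic integer, that is, of the principal ideal it generates
(so the norm of `0` is `0`). -/
noncomputable def intNorm {K : Type*} [Field K] [NumberField K]
    (a : NumberField.RingOfIntegers K) : ℕ :=
  Ideal.absNorm (Ideal.span {a})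

/-- The truncated angular sector `C(z, θ, R)`, with axis through `z`, angle `θ` and radius `R`. -/
def truncatedSector (z : ℂ) (θ R : ℝ) : Set ℂ :=
  {w | ∃ t ∈ Set.Ioc (-(θ / 2)) (θ / 2), ∃ ρ ∈ Set.Ioc 0 (R / ‖z‖),
    w = (ρ : ℂ) * Complex.exp ((t : ℂ) * Complex.I) * z}

/-- The elements of the ideal `m` lying in the sector `C(z, θ, R)`, where `K` is seen as a
subfield of `ℂ` by means of the embedding `σ`. -/
def sectorPoints {K : Type*} [Field K] [NumberField K] (σ : K →+* ℂ)
    (m : Ideal (NumberField.RingOfIntegers K)) (z : ℂ) (θ R : ℝ) :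
    Set (NumberField.RingOfIntegers K) :=
  {a | a ∈ m ∧ σ (a : K) ∈ truncatedSector z θ R}

/-- The sum of `φ_K(a) φ_K(a + k)` over the elements `a` of `m` in the sector `C(z, θ, x)`.
Elements of the sector are nonzero; the possible element `a = -k`, at which `φ_K(a + k)` is
not defined, is left out. -/
noncomputable def shiftedEulerSum {K : Type*} [Field K] [NumberField K] (σ : K →+* ℂ)
    (m : Ideal (NumberField.RingOfIntegers K)) (k : NumberField.RingOfIntegers K)
    (z : ℂ) (θ x : ℝ) : ℝ :=
  ∑ᶠ a ∈ {a | a ∈ sectorPoints σ m z θ x ∧ a + k ≠ 0}, (eulerPhi a : ℝ) * (eulerPhi (a + k) : ℝ)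

/-!
Write `|a|` for the absolute value of an algebraic integer `a` in `ℂ`, so that `N(a) = |a|²`.
By inclusion-exclusion over prime ideals, `φ(a) / N(a)` is the sum of `μ(I) / N(I)` over the
squarefree ideals `I` dividing `a` (`phiRatio_eq_sum`). Therefore the sum `A(r)` of
`φ(a) φ(a + k) / (N(a) N(a + k))` over the points of `m` in the sector of radius `r` is a double
sum over squarefree ideals `I`, `J` of `μ(I) μ(J) / (N(I) N(J))` times the number of points `a` of
the sector with `a ∈ m ∩ I` and `a + k ∈ J`. These points form the trace of the sector on a coset
of `m ∩ I ∩ J` (or the empty set).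

Two kinds of uniformity in the field are needed. First, the number of points of a coset of a
nonzero ideal `L` in the sector is `θ r² / (√|D| N(L))` up to an absolute constant times
`r / √N(L) + 1` (`count_coset`). As `L` is principal, it suffices to treat translates of the lattice
`ℤ + ℤ ω` with `Im ω = √|D| / 2`. A convex piece of the sector meets a horizontal or vertical line
in an interval, and Fubini's theorem, used once for the rows and once for the columns of the
lattice, compares the number of lattice points with the area (`Convex.count_lattice`).
Second, `∑ N(I) ^ (-5/4)` over squarefree ideals is bounded by an absolute constant, by comparing
generators with points of `ℤ²` (`tsum_absNorm_rpow_le`).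

For `r ≥ |k|` only ideals of norm at most `4 r²` contribute, and `N(m ∩ I ∩ J) ≥ √(N(I) N(J))`; so
the error for the pair `(I, J)` is at most an absolute constant times `r (N(I) N(J)) ^ (-5/4)`
(`count_divisible_summable`). Summing over the pairs gives `A(r) = θ c r² / √|D| + O(r)`
(`ratioSum_asymptotic`). For `r < |k|` both sides are trivially `O(r²) = O(|k| r)`.
Letting `r` tend to infinity, `c ≤ 1` follows from `φ(a) ≤ N(a)`. For `c > 0`, the average over `a`
of `∑ 1 / N(p)`, for the primes `p` dividing `a (a + k)`, is bounded, and convexity of the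
exponential turns this into a lower bound for the average of `φ(a) φ(a + k) / (N(a) N(a + k))`.

Finally, summation by parts yields the sum weighted by `N(a)²` (`sum_fourth_pow_asymptotic`), and
replacing `N(a + k)` by `N(a)` costs at most `|k| (2 |a| + |k|)` for each `a`.
-/

open MeasureTheory

/-! ### Counting points of lattices in convex sets -/

/-- A bounded interval `J` of the line contains `vol(J) / h + O(1)` terms of an arithmetic
progression with difference `h`; the bound is stated after multiplication by `h`. -/
lemma Set.OrdConnected.count_arithmeticProgression {J : Set ℝ} (hJ : J.OrdConnected)
    (hb : Bornology.IsBounded J) (s : ℝ) {h : ℝ} (hh : 0 < h) :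
    {n : ℤ | s + n * h ∈ J}.Finite ∧
      |h * ({n : ℤ | s + n * h ∈ J}.ncard : ℝ) - volume.real J| ≤ h := by
  rcases J.eq_empty_or_nonempty with rfl | hne
  · simp [hh.le]
  set a := sInf J with ha
  set b := sSup J with hbdef
  have hba := hb.bddAbove
  have hbb := hb.bddBelow
  have hsub : J ⊆ Set.Icc a b := fun x hx => ⟨csInf_le hbb hx, le_csSup hba hx⟩
  have hsup : Set.Ioo a b ⊆ J := by
    rintro x ⟨hx1, hx2⟩
    obtain ⟨y, hy, hyx⟩ := exists_lt_of_csInf_lt hne hx1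
    obtain ⟨w, hw, hxw⟩ := exists_lt_of_lt_csSup hne hx2
    exact hJ.out hy hw ⟨hyx.le, hxw.le⟩
  have hab : a ≤ b := by
    obtain ⟨x, hx⟩ := hne
    exact (hsub hx).1.trans (hsub hx).2
  have hvol : volume.real J = b - a := by
    apply le_antisymm
    · have := measureReal_mono (μ := volume) hsub (by simp)
      simpa [hab] using this
    · have := measureReal_mono (μ := volume) hsup hb.measure_lt_top.ne
      simpa [hab] using this
  set A : Set ℤ := {n : ℤ | s + n * h ∈ J} with hA
  have hA1 : A ⊆ (Finset.Icc ⌈(a - s) / h⌉ ⌊(b - s) / h⌋ : Finset ℤ) := by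
    intro n hn
    have := hsub hn
    rw [Finset.coe_Icc, Set.mem_Icc, Int.ceil_le, Int.le_floor, div_le_iff₀ hh, le_div_iff₀ hh]
    exact ⟨by linarith [this.1], by linarith [this.2]⟩
  have hA2 : ((Finset.Icc (⌊(a - s) / h⌋ + 1) (⌈(b - s) / h⌉ - 1) : Finset ℤ) : Set ℤ) ⊆ A := by
    intro n hn
    rw [Finset.coe_Icc, Set.mem_Icc] at hn
    have h1 : (a - s) / h < n := Int.floor_lt.mp (by omega)
    have h2 : (n : ℝ) < (b - s) / h := Int.lt_ceil.mp (by omega)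
    rw [div_lt_iff₀ hh] at h1
    rw [lt_div_iff₀ hh] at h2
    exact hsup ⟨by linarith, by linarith⟩
  have hfin : A.Finite := (Finset.finite_toSet _).subset hA1
  refine ⟨hfin, ?_⟩
  have c1 := Set.ncard_le_ncard hA1 (Finset.finite_toSet _)
  have c2 := Set.ncard_le_ncard hA2 hfin
  rw [Set.ncard_coe_finset, Int.card_Icc] at c1 c2
  have key : (b - s) / h - (a - s) / h = (b - a) / h := by ring
  have c1' : (A.ncard : ℝ) ≤ (b - a) / h + 1 := by
    have h0 : (0 : ℝ) ≤ (b - a) / h := div_nonneg (by linarith) hh.le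
    have : (A.ncard : ℤ) ≤ max (⌊(b - s) / h⌋ + 1 - ⌈(a - s) / h⌉) 0 := by
      rw [← Int.toNat_eq_max]; exact_mod_cast c1
    have : (A.ncard : ℝ) ≤ max ((⌊(b - s) / h⌋ : ℝ) + 1 - ⌈(a - s) / h⌉) 0 := by exact_mod_cast this
    refine this.trans (max_le ?_ (by linarith))
    have := Int.floor_le ((b - s) / h)
    have := Int.le_ceil ((a - s) / h)
    linarith
  have c2' : (b - a) / h - 1 ≤ A.ncard := by
    have : ⌈(b - s) / h⌉ - 1 + 1 - (⌊(a - s) / h⌋ + 1) ≤ (A.ncard : ℤ) := by omega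
    have : (⌈(b - s) / h⌉ : ℝ) - 1 + 1 - (⌊(a - s) / h⌋ + 1) ≤ A.ncard := by exact_mod_cast this
    have := Int.floor_le ((a - s) / h)
    have := Int.le_ceil ((b - s) / h)
    linarith
  rw [hvol, abs_le]
  have e : h * ((b - a) / h) = b - a := by field_simp
  constructor <;> nlinarith

/-- The number of points of a translate of the lattice generated by `(1, 0)` and `(s, h)` in a
convex planar set `E`, compared with `vol(E) / h`. The error does not involve the shear `s`, and it
stays `O(R + 1)` after division by `h` when `h` is large. -/
lemma Convex.count_lattice {E : Set (ℝ × ℝ)} (hE : Convex ℝ E) (hEm : MeasurableSet E) {R : ℝ}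
    (hR : 0 ≤ R) (hER : E ⊆ Set.Icc (-R) R ×ˢ Set.Icc (-R) R) (x y s : ℝ) {h : ℝ} (hh : 0 < h) :
    {n : ℤ × ℤ | (x + n.1 + n.2 * s, y + n.2 * h) ∈ E}.Finite ∧
      |h * ({n : ℤ × ℤ | (x + n.1 + n.2 * s, y + n.2 * h) ∈ E}.ncard : ℝ) - volume.real E|
        ≤ 2 * R + h + 2 * R * h := by
  have hIcc : (Set.Icc (-R) R).OrdConnected := Set.ordConnected_Icc
  have hIb : Bornology.IsBounded (Set.Icc (-R) R) := Metric.isBounded_Icc _ _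
  -- horizontal and vertical slices
  have hrow : ∀ b : ℝ, {a | (a, b) ∈ E}.OrdConnected ∧ Bornology.IsBounded {a | (a, b) ∈ E} := by
    intro b
    refine ⟨Convex.ordConnected fun a ha a' ha' p q hp hq hpq => ?_,
      hIb.subset fun a ha => (hER ha).1⟩
    have := hE ha ha' hp hq hpq
    rwa [Prod.smul_mk, Prod.smul_mk, Prod.mk_add_mk, ← add_smul, hpq, one_smul] at this
  have hcol : ∀ a : ℝ, {b | (a, b) ∈ E}.OrdConnected ∧ Bornology.IsBounded {b | (a, b) ∈ E} := by
    intro a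
    refine ⟨Convex.ordConnected fun b hb b' hb' p q hp hq hpq => ?_,
      hIb.subset fun b hb => (hER hb).2⟩
    have := hE hb hb' hp hq hpq
    rwa [Prod.smul_mk, Prod.smul_mk, Prod.mk_add_mk, ← add_smul, hpq, one_smul] at this
  have hEb : Bornology.IsBounded E := (hIb.prod hIb).subset hER
  obtain ⟨hVfin, hVc⟩ := hIcc.count_arithmeticProgression hIb y hh
  set V := hVfin.toFinset with hV
  have hVmem : ∀ v : ℤ, v ∈ V ↔ y + v * h ∈ Set.Icc (-R) R := by intro v; simp [hV]
  have hvolI : volume.real (Set.Icc (-R) R) = 2 * R := by simp [hR]; ring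
  rw [hvolI, Set.ncard_eq_toFinset_card _ hVfin] at hVc
  set row : ℤ → Set ℤ := fun v => {u : ℤ | (x + v * s) + u * (1 : ℝ) ∈ {a | (a, y + v * h) ∈ E}}
    with hrowdef
  have hrowc := fun v : ℤ =>
    (hrow (y + v * h)).1.count_arithmeticProgression (hrow (y + v * h)).2 (x + v * s) one_pos
  set P := {n : ℤ × ℤ | (x + n.1 + n.2 * s, y + n.2 * h) ∈ E} with hP
  have hProw : ∀ u v : ℤ, (u, v) ∈ P ↔ u ∈ row v := by
    intro u v
    simp only [hP, hrowdef, Set.mem_ofPred_eq]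
    rw [show x + (u : ℝ) + v * s = x + v * s + u * 1 by ring]
  have hPfin : P.Finite := by
    refine (V.finite_toSet.biUnion fun v _ => ((hrowc v).1.image fun u => (u, v))).subset ?_
    rintro ⟨u, v⟩ hn
    simp only [Set.mem_iUnion]
    exact ⟨v, (hVmem v).2 (hER hn).2, u, (hProw u v).1 hn, rfl⟩
  refine ⟨hPfin, ?_⟩
  have hcard : (P.ncard : ℝ) = ∑ v ∈ V, ((row v).ncard : ℝ) := by
    rw [Set.ncard_eq_toFinset_card _ hPfin,
      Finset.card_eq_sum_card_fiberwise (f := Prod.snd) (t := V)]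
    · push_cast
      refine Finset.sum_congr rfl fun v hv => ?_
      congr 1
      rw [← Set.ncard_coe_finset, ← Set.ncard_image_of_injective (row v)
        (f := fun u : ℤ => (u, v)) (fun a b hab => (Prod.mk.inj hab).1)]
      congr 1
      ext ⟨u, w⟩
      simp only [Finset.coe_filter, Set.Finite.mem_toFinset, Set.mem_ofPred_eq, Set.mem_image,
        Prod.mk.injEq]
      constructor
      · rintro ⟨h1, rfl⟩
        exact ⟨u, (hProw u _).1 h1, rfl, rfl⟩
      · rintro ⟨u', h1, rfl, rfl⟩
        exact ⟨(hProw _ _).2 h1, rfl⟩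
    · rintro ⟨u, v⟩ hn
      exact (hVmem v).2 (hER ((Set.Finite.mem_toFinset hPfin).1 hn)).2
  -- the lengths of the rows
  have hmeasrow : ∀ b : ℝ, MeasurableSet {a | (a, b) ∈ E} := fun b => (hrow b).1.measurableSet
  have hmeascol : ∀ a : ℝ, MeasurableSet {b | (a, b) ∈ E} := fun a => (hcol a).1.measurableSet
  have hlen : ∀ b : ℝ, volume.real {a | (a, b) ∈ E}
      = ∫ a in Set.Icc (-R) R, Set.indicator E (fun _ => (1 : ℝ)) (a, b) := by
    intro b
    have : (fun a => Set.indicator E (fun _ => (1 : ℝ)) (a, b))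
        = Set.indicator {a | (a, b) ∈ E} (fun _ => (1 : ℝ)) := rfl
    rw [this, integral_indicator (hmeasrow b), Measure.restrict_restrict (hmeasrow b),
      Set.inter_eq_left.2 (show {a | (a, b) ∈ E} ⊆ Set.Icc (-R) R from fun a ha => (hER ha).1)]
    simp
  have hint1 : ∀ b : ℝ, IntegrableOn (fun a => Set.indicator E (fun _ => (1 : ℝ)) (a, b))
      (Set.Icc (-R) R) := by
    intro b
    have : (fun a => Set.indicator E (fun _ => (1 : ℝ)) (a, b))
        = Set.indicator {a | (a, b) ∈ E} (fun _ => (1 : ℝ)) := rfl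
    rw [this]
    exact (integrable_const (1 : ℝ)).indicator (hmeasrow b)
  have hintE : Integrable (Set.indicator E (fun _ => (1 : ℝ))) := by
    rw [integrable_indicator_iff hEm]
    exact integrableOn_const hEb.measure_lt_top.ne
  have harea : volume.real E
      = ∫ a in Set.Icc (-R) R, volume.real {b | (a, b) ∈ E} := by
    have h1 : volume.real E = ∫ p, Set.indicator E (fun _ => (1 : ℝ)) p := by
      rw [integral_indicator hEm]; simp
    rw [h1, Measure.volume_eq_prod, integral_prod _ hintE, ← integral_indicator measurableSet_Icc]
    congr 1
    ext a
    have h2 : (fun b => Set.indicator E (fun _ => (1 : ℝ)) (a, b))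
        = Set.indicator {b | (a, b) ∈ E} (fun _ => (1 : ℝ)) := rfl
    rw [h2, integral_indicator (hmeascol a)]
    by_cases ha : a ∈ Set.Icc (-R) R
    · rw [Set.indicator_of_mem ha]; simp
    · have : {b | (a, b) ∈ E} = ∅ := by
        ext b; simp only [Set.mem_ofPred_eq, Set.mem_empty_iff_false, iff_false]
        exact fun hb => ha (hER hb).1
      rw [Set.indicator_of_notMem ha, this]; simp
  have hareaInt : IntegrableOn (fun a => volume.real {b | (a, b) ∈ E}) (Set.Icc (-R) R) := by
    have := hintE
    rw [Measure.volume_eq_prod] at this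
    have := this.integral_prod_left
    refine (this.integrableOn (s := Set.Icc (-R) R)).congr_fun (fun a _ => ?_) measurableSet_Icc
    have h2 : (fun b => Set.indicator E (fun _ => (1 : ℝ)) (a, b))
        = Set.indicator {b | (a, b) ∈ E} (fun _ => (1 : ℝ)) := rfl
    simp only [h2]
    rw [integral_indicator (hmeascol a)]; simp
  -- Fubini: the total length of the rows is the integral over the columns of the number of rows
  -- that they meet, and `E` itself is the integral of the lengths of its columns
  have hsum : h * ∑ v ∈ V, volume.real {a | (a, y + v * h) ∈ E} - volume.real E
      = ∫ a in Set.Icc (-R) R, (h * ∑ v ∈ V, Set.indicator E (fun _ => (1 : ℝ)) (a, y + v * h)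
          - volume.real {b | (a, b) ∈ E}) := by
    rw [integral_sub _ hareaInt, ← harea, integral_const_mul, integral_finsetSum]
    · simp only [hlen]
    · exact fun v _ => hint1 _
    · exact (integrable_finsetSum _ fun v _ => hint1 _).const_mul h
  have hcolbd : ∀ a : ℝ, |h * ∑ v ∈ V, Set.indicator E (fun _ => (1 : ℝ)) (a, y + v * h)
          - volume.real {b | (a, b) ∈ E}| ≤ h := by
    intro a
    obtain ⟨hf, hc⟩ := (hcol a).1.count_arithmeticProgression (hcol a).2 y hh
    classical
    convert hc using 4
    have : ∀ v : ℤ, Set.indicator E (fun _ => (1 : ℝ)) (a, y + v * h)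
        = if (a, y + v * h) ∈ E then 1 else 0 := by
      intro v; rw [Set.indicator_apply]
    rw [Finset.sum_congr rfl fun v _ => this v, Finset.sum_boole, ← Set.ncard_coe_finset]
    congr 2
    ext v
    simp only [Finset.coe_filter, Set.mem_ofPred_eq, and_iff_right_iff_imp]
    exact fun hv => (hVmem v).2 (hER hv).2
  have hbound2 : |h * ∑ v ∈ V, volume.real {a | (a, y + v * h) ∈ E} - volume.real E|
      ≤ 2 * R * h := by
    rw [hsum, ← Real.norm_eq_abs]
    refine (norm_setIntegral_le_of_norm_le_const (by simp) (fun a _ => hcolbd a)).trans ?_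
    rw [hvolI]; linarith
  have hbound1 : |h * (P.ncard : ℝ) - h * ∑ v ∈ V, volume.real {a | (a, y + v * h) ∈ E}|
      ≤ 2 * R + h := by
    rw [hcard, ← mul_sub, ← Finset.sum_sub_distrib, abs_mul, abs_of_pos hh]
    have : |∑ v ∈ V, (((row v).ncard : ℝ) - volume.real {a | (a, y + v * h) ∈ E})| ≤ V.card := by
      refine (Finset.abs_sum_le_sum_abs _ _).trans ?_
      refine (Finset.sum_le_sum (g := fun _ => (1 : ℝ)) fun v _ => ?_).trans (by simp)
      have := (hrowc v).2
      rwa [one_mul] at this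
    have h3 := (abs_le.1 hVc).2
    nlinarith
  have := abs_add_le (h * (P.ncard : ℝ) - h * ∑ v ∈ V, volume.real {a | (a, y + v * h) ∈ E})
    (h * ∑ v ∈ V, volume.real {a | (a, y + v * h) ∈ E} - volume.real E)
  rw [sub_add_sub_cancel] at this
  linarith

/-! ### Angular sectors -/

/-- The set of complex numbers of modulus in `(0, R]` having an argument in `(α, β]`. -/
def angularSector (α β R : ℝ) : Set ℂ :=
  {w | ∃ t ∈ Set.Ioc α β, ∃ ρ ∈ Set.Ioc 0 R, w = (ρ : ℂ) * Complex.exp ((t : ℂ) * Complex.I)}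

lemma norm_le_of_mem_angularSector {α β R : ℝ} {w : ℂ} (hw : w ∈ angularSector α β R) :
    ‖w‖ ≤ R := by
  obtain ⟨t, -, ρ, hρ, rfl⟩ := hw
  rw [norm_mul, Complex.norm_exp_ofReal_mul_I, Complex.norm_real, Real.norm_eq_abs,
    abs_of_pos hρ.1, mul_one]
  exact hρ.2

lemma ne_zero_of_mem_angularSector {α β R : ℝ} {w : ℂ} (hw : w ∈ angularSector α β R) :
    w ≠ 0 := by
  obtain ⟨t, -, ρ, hρ, rfl⟩ := hw
  exact mul_ne_zero (Complex.ofReal_ne_zero.2 hρ.1.ne') (Complex.exp_ne_zero _)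

lemma mem_angularSector_of_le {α β R r : ℝ} {w : ℂ} :
    w ∈ angularSector α β R ∧ ‖w‖ ≤ r ∧ r ≤ R ↔ w ∈ angularSector α β r ∧ r ≤ R := by
  constructor
  · rintro ⟨⟨t, ht, ρ, hρ, rfl⟩, hr, hR⟩
    rw [norm_mul, Complex.norm_exp_ofReal_mul_I, Complex.norm_real, Real.norm_eq_abs,
      abs_of_pos hρ.1, mul_one] at hr
    exact ⟨⟨t, ht, ρ, ⟨hρ.1, hr⟩, rfl⟩, hR⟩
  · rintro ⟨h, hR⟩
    refine ⟨?_, norm_le_of_mem_angularSector h, hR⟩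
    obtain ⟨t, ht, ρ, hρ, rfl⟩ := h
    exact ⟨t, ht, ρ, ⟨hρ.1, hρ.2.trans hR⟩, rfl⟩

/-- Multiplication by `v` rotates and dilates sectors. -/
lemma mul_mem_angularSector_iff {v : ℂ} (hv : v ≠ 0) {α β R : ℝ} {w : ℂ} :
    w * v ∈ angularSector α β R ↔ w ∈ angularSector (α - v.arg) (β - v.arg) (R / ‖v‖) := by
  have hn : 0 < ‖v‖ := norm_pos_iff.2 hv
  have hn' : (‖v‖ : ℂ) ≠ 0 := by exact_mod_cast hn.ne'
  have hvp := Complex.norm_mul_exp_arg_mul_I v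
  constructor
  · rintro ⟨t, ht, ρ, hρ, h⟩
    refine ⟨t - v.arg, ⟨by linarith [ht.1], by linarith [ht.2]⟩, ρ / ‖v‖,
      ⟨div_pos hρ.1 hn, by gcongr; exact hρ.2⟩, ?_⟩
    apply mul_right_cancel₀ hv
    rw [h]
    nth_rw 3 [← hvp]
    push_cast
    rw [sub_mul, Complex.exp_sub]
    field_simp [Complex.exp_ne_zero]
  · rintro ⟨t, ht, ρ, hρ, h⟩
    refine ⟨t + v.arg, ⟨by linarith [ht.1], by linarith [ht.2]⟩, ρ * ‖v‖,
      ⟨mul_pos hρ.1 hn, (le_div_iff₀ hn).1 hρ.2⟩, ?_⟩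
    rw [h]
    nth_rw 1 [← hvp]
    push_cast
    rw [add_mul, Complex.exp_add]
    ring

lemma truncatedSector_eq_angularSector {z : ℂ} (hz : z ≠ 0) (θ R : ℝ) :
    truncatedSector z θ R = angularSector (z.arg - θ / 2) (z.arg + θ / 2) R := by
  ext w
  have : w = w / z * z := by field_simp
  rw [this, mul_mem_angularSector_iff hz]
  simp only [truncatedSector, angularSector, Set.mem_ofPred_eq, mul_left_inj' hz]
  rw [show z.arg - θ / 2 - z.arg = -(θ / 2) by ring, show z.arg + θ / 2 - z.arg = θ / 2 by ring]

lemma angularSector_eq_union {α β γ : ℝ} (h1 : α ≤ β) (h2 : β ≤ γ) (R : ℝ) :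
    angularSector α γ R = angularSector α β R ∪ angularSector β γ R := by
  ext w
  simp only [angularSector, Set.mem_union, Set.mem_ofPred_eq]
  rw [← Set.Ioc_union_Ioc_eq_Ioc h1 h2]
  simp only [Set.mem_union, or_and_right, exists_or]

/-- Consecutive sectors of total angle at most `2π` do not overlap. -/
lemma disjoint_angularSector {α β γ : ℝ} (h : γ - α ≤ 2 * Real.pi) (R : ℝ) :
    Disjoint (angularSector α β R) (angularSector β γ R) := by
  rw [Set.disjoint_left]
  rintro w ⟨t, ht, ρ, hρ, rfl⟩ ⟨t', ht', ρ', hρ', h'⟩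
  have hn := congrArg norm h'
  simp only [norm_mul, Complex.norm_exp_ofReal_mul_I, Complex.norm_real, Real.norm_eq_abs,
    abs_of_pos hρ.1, abs_of_pos hρ'.1, mul_one] at hn
  subst hn
  have h1 := mul_left_cancel₀ (Complex.ofReal_ne_zero.2 hρ.1.ne') h'
  obtain ⟨n, hn⟩ := Complex.exp_eq_exp_iff_exists_int.1 h1
  have h2 : t = t' + n * (2 * Real.pi) := by
    have := congrArg Complex.im hn
    simpa using this
  have hpi := Real.pi_pos
  have hn1 : (n : ℝ) < 0 := by nlinarith [ht.1, ht.2, ht'.1, ht'.2]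
  have hn2 : (-1 : ℝ) < n := by nlinarith [ht.1, ht.2, ht'.1, ht'.2]
  have hn1' : n < 0 := by exact_mod_cast hn1
  have hn2' : -1 < n := by exact_mod_cast hn2
  omega

/-- An angle smaller than `π` is the intersection of two half-planes. -/
lemma mem_angularSector_iff_im {α β : ℝ} (h1 : α < β) (h2 : β - α < Real.pi) {R : ℝ} {w : ℂ} :
    w ∈ angularSector α β R ↔ ‖w‖ ≤ R ∧ 0 < (w * Complex.exp ((-α : ℝ) * Complex.I)).im ∧
      (w * Complex.exp ((-β : ℝ) * Complex.I)).im ≤ 0 := by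
  have key : ∀ ρ t s : ℝ, ((ρ : ℂ) * Complex.exp ((t : ℂ) * Complex.I) *
      Complex.exp ((-s : ℝ) * Complex.I)).im = ρ * Real.sin (t - s) := by
    intro ρ t s
    rw [mul_assoc, ← Complex.exp_add, ← add_mul, ← Complex.ofReal_add, Complex.im_ofReal_mul,
      Complex.exp_ofReal_mul_I_im, sub_eq_add_neg]
  constructor
  · intro hw
    refine ⟨norm_le_of_mem_angularSector hw, ?_⟩
    obtain ⟨t, ht, ρ, hρ, rfl⟩ := hw
    rw [key, key]
    constructor
    · exact mul_pos hρ.1 (Real.sin_pos_of_pos_of_lt_pi (by linarith [ht.1]) (by linarith [ht.2]))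
    · exact mul_nonpos_of_nonneg_of_nonpos hρ.1.le
        (Real.sin_nonpos_of_nonpos_of_neg_pi_le (by linarith [ht.2]) (by linarith [ht.1]))
  · rintro ⟨hR, hα, hβ⟩
    set v := w * Complex.exp ((-α : ℝ) * Complex.I) with hv
    have hv0 : v ≠ 0 := fun h => by simp [h] at hα
    have hwn : ‖w‖ = ‖v‖ := by rw [hv, norm_mul, Complex.norm_exp_ofReal_mul_I, mul_one]
    have hwv : w = (‖v‖ : ℝ) * Complex.exp (((v.arg + α : ℝ) : ℂ) * Complex.I) := by
      push_cast
      rw [add_mul, Complex.exp_add, ← mul_assoc, Complex.norm_mul_exp_arg_mul_I, hv, mul_assoc,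
        ← Complex.exp_add]
      simp
    have ha0 : 0 ≤ v.arg := Complex.arg_nonneg_iff.2 hα.le
    have ha1 : 0 < v.arg := lt_of_le_of_ne ha0 fun h => by
      have := (Complex.arg_eq_zero_iff.1 h.symm).2
      linarith
    have ha2 : v.arg < Real.pi := Complex.arg_lt_pi_iff.2 (Or.inr hα.ne')
    have hn : 0 < ‖v‖ := norm_pos_iff.2 hv0
    refine ⟨v.arg + α, ⟨by linarith, ?_⟩, ‖v‖, ⟨hn, hwn ▸ hR⟩, hwv⟩
    by_contra! hlt
    rw [hwv, key] at hβ
    have := mul_pos hn (Real.sin_pos_of_pos_of_lt_pi (x := v.arg + α - β) (by linarith) (by linarith))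
    linarith

lemma isLinear_im_mul (c : ℂ) : IsLinearMap ℝ fun w : ℂ => (w * c).im :=
  ⟨fun x y => by simp [add_mul], fun r x => by simp; ring⟩

lemma convex_angularSector {α β : ℝ} (h1 : α < β) (h2 : β - α < Real.pi) (R : ℝ) :
    Convex ℝ (angularSector α β R) := by
  have : angularSector α β R = Metric.closedBall 0 R ∩
      ({w | 0 < (w * Complex.exp ((-α : ℝ) * Complex.I)).im} ∩
        {w | (w * Complex.exp ((-β : ℝ) * Complex.I)).im ≤ 0}) := by
    ext w
    rw [mem_angularSector_iff_im h1 h2]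
    simp
  rw [this]
  exact (convex_closedBall _ _).inter ((convex_halfSpace_gt (isLinear_im_mul _) _).inter
    (convex_halfSpace_le (isLinear_im_mul _) _))

lemma measurableSet_angularSector {α β : ℝ} (h1 : α < β) (h2 : β - α < Real.pi) (R : ℝ) :
    MeasurableSet (angularSector α β R) := by
  have : angularSector α β R = Metric.closedBall 0 R ∩
      ({w | 0 < (w * Complex.exp ((-α : ℝ) * Complex.I)).im} ∩
        {w | (w * Complex.exp ((-β : ℝ) * Complex.I)).im ≤ 0}) := by
    ext w
    rw [mem_angularSector_iff_im h1 h2]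
    simp
  rw [this]
  refine Metric.isClosed_closedBall.measurableSet.inter (MeasurableSet.inter ?_ ?_)
  · exact measurableSet_lt (by fun_prop) (by fun_prop)
  · exact measurableSet_le (by fun_prop) (by fun_prop)

lemma volume_angularSector_symm {δ : ℝ} (h1 : 0 < δ) (h2 : 2 * δ < Real.pi) {R : ℝ} (hR : 0 ≤ R) :
    volume.real (angularSector (-δ) δ R) = δ * R ^ 2 := by
  have hm := measurableSet_angularSector (α := -δ) (β := δ) (by linarith) (by linarith) R
  have e1 : volume.real (angularSector (-δ) δ R)
      = ∫ w, Set.indicator (angularSector (-δ) δ R) (fun _ => (1 : ℝ)) w := by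
    rw [integral_indicator hm]; simp
  rw [e1, ← Complex.integral_comp_polarCoord_symm]
  have e2 : ∀ p ∈ polarCoord.target,
      p.1 • Set.indicator (angularSector (-δ) δ R) (fun _ => (1 : ℝ)) (Complex.polarCoord.symm p)
        = Set.indicator (Set.Ioc 0 R ×ˢ Set.Ioc (-δ) δ) (fun p : ℝ × ℝ => p.1 * 1) p := by
    rintro ⟨r, t⟩ hp
    simp only [polarCoord_target, Set.mem_prod, Set.mem_Ioi, Set.mem_Ioo] at hp
    obtain ⟨hr, ht1, ht2⟩ := hp
    have harg : ((r : ℂ) * (Real.cos t + Real.sin t * Complex.I)).arg = t := by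
      have := Complex.arg_mul_cos_add_sin_mul_I hr ⟨ht1, ht2.le⟩
      simpa using this
    rw [Complex.polarCoord_symm_apply]
    have hiff : (r : ℂ) * (Real.cos t + Real.sin t * Complex.I) ∈ angularSector (-δ) δ R
        ↔ (r, t) ∈ Set.Ioc 0 R ×ˢ Set.Ioc (-δ) δ := by
      constructor
      · intro h
        have hnorm := norm_le_of_mem_angularSector h
        obtain ⟨t', ht', ρ, hρ, h'⟩ := h
        have := congrArg Complex.arg h'
        rw [harg, Complex.exp_mul_I,
          Complex.arg_mul_cos_add_sin_mul_I hρ.1 ⟨by linarith [ht'.1], by linarith [ht'.2]⟩] at this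
        subst this
        have : (Real.cos t : ℂ) + Real.sin t * Complex.I = Complex.exp (t * Complex.I) := by
          rw [Complex.exp_mul_I]; simp
        rw [this, norm_mul, Complex.norm_exp_ofReal_mul_I, Complex.norm_real, Real.norm_eq_abs,
          abs_of_pos hr, mul_one] at hnorm
        exact ⟨⟨hr, hnorm⟩, ht'⟩
      · rintro ⟨hr', ht'⟩
        refine ⟨t, ht', r, hr', ?_⟩
        rw [Complex.exp_mul_I]; simp
    by_cases hin : (r, t) ∈ Set.Ioc 0 R ×ˢ Set.Ioc (-δ) δ
    · rw [Set.indicator_of_mem hin, Set.indicator_of_mem (hiff.2 hin)]; simp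
    · rw [Set.indicator_of_notMem hin, Set.indicator_of_notMem (fun h => hin (hiff.1 h))]; simp
  have hmt : MeasurableSet polarCoord.target := polarCoord.open_target.measurableSet
  rw [setIntegral_congr_fun hmt e2, setIntegral_indicator (measurableSet_Ioc.prod measurableSet_Ioc),
    Set.inter_eq_right.2, Measure.volume_eq_prod, setIntegral_prod_mul (fun r : ℝ => r) (fun _ : ℝ => (1 : ℝ)),
    ← intervalIntegral.integral_of_le hR, integral_id]
  · simp [h1.le]
    ring
  · rintro ⟨r, t⟩ ⟨hr, ht⟩
    simp only [polarCoord_target, Set.mem_prod, Set.mem_Ioi, Set.mem_Ioo]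
    exact ⟨hr.1, by linarith [ht.1], by linarith [ht.2]⟩

lemma volume_angularSector {α β : ℝ} (h1 : α < β) (h2 : β - α < Real.pi) {R : ℝ} (hR : 0 ≤ R) :
    volume.real (angularSector α β R) = (β - α) / 2 * R ^ 2 := by
  set γ := (α + β) / 2 with hγ
  have h := volume_angularSector_symm (δ := (β - α) / 2) (by linarith) (by linarith) hR
  rw [← h]
  have hpre : angularSector (-((β - α) / 2)) ((β - α) / 2) R =
      (rotation (Circle.exp γ)) ⁻¹' angularSector α β R := by
    ext w
    simp only [Set.mem_preimage, rotation_apply, Circle.coe_exp]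
    constructor
    · rintro ⟨t, ht, ρ, hρ, rfl⟩
      refine ⟨γ + t, ⟨by linarith [ht.1], by linarith [ht.2]⟩, ρ, hρ, ?_⟩
      push_cast
      rw [add_mul, Complex.exp_add]; ring
    · rintro ⟨t, ht, ρ, hρ, h⟩
      refine ⟨t - γ, ⟨by linarith [ht.1], by linarith [ht.2]⟩, ρ, hρ, ?_⟩
      apply mul_left_cancel₀ (Complex.exp_ne_zero (γ * Complex.I))
      rw [h]
      push_cast
      rw [sub_mul, Complex.exp_sub]
      field_simp [Complex.exp_ne_zero]
  rw [hpre, measureReal_def, measureReal_def, (rotation (Circle.exp γ)).measurePreserving.measure_preimage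
    (measurableSet_angularSector h1 h2 R).nullMeasurableSet]

/-- Lattice points `w + u + v ω` in an angular sector narrow enough to be convex. -/
lemma count_angularSector_narrow {α β : ℝ} (h1 : α < β) (h2 : β - α < Real.pi) {R : ℝ} (hR : 0 ≤ R)
    (w ω : ℂ) (hω : 2 / 3 ≤ ω.im) :
    {n : ℤ × ℤ | w + n.1 + n.2 * ω ∈ angularSector α β R}.Finite ∧
      |({n : ℤ × ℤ | w + n.1 + n.2 * ω ∈ angularSector α β R}.ncard : ℝ)
        - (β - α) * R ^ 2 / (2 * ω.im)| ≤ 5 * (R + 1) := by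
  set E := Complex.measurableEquivRealProd.symm ⁻¹' angularSector α β R with hE
  have hmem : ∀ p : ℝ × ℝ, p ∈ E ↔ (⟨p.1, p.2⟩ : ℂ) ∈ angularSector α β R := fun p => Iff.rfl
  have hm := measurableSet_angularSector h1 h2 R
  have hEm : MeasurableSet E := Complex.measurableEquivRealProd.symm.measurable hm
  have hEv : volume.real E = (β - α) / 2 * R ^ 2 := by
    rw [← volume_angularSector h1 h2 hR, measureReal_def, measureReal_def,
      Complex.volume_preserving_equiv_real_prod.symm.measure_preimage hm.nullMeasurableSet]
  have hEc : Convex ℝ E := by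
    intro p hp q hq s t hs ht hst
    have := convex_angularSector h1 h2 R ((hmem p).1 hp) ((hmem q).1 hq) hs ht hst
    rw [hmem]
    convert this using 1
    apply Complex.ext <;> simp
  have hER : E ⊆ Set.Icc (-R) R ×ˢ Set.Icc (-R) R := by
    intro p hp
    have := norm_le_of_mem_angularSector ((hmem p).1 hp)
    have h3 := (Complex.abs_re_le_norm _).trans this
    have h4 := (Complex.abs_im_le_norm _).trans this
    exact ⟨abs_le.1 h3, abs_le.1 h4⟩
  have hpos : 0 < ω.im := by linarith
  have key := hEc.count_lattice hEm hR hER w.re w.im ω.re hpos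
  have hset : {n : ℤ × ℤ | (w.re + n.1 + n.2 * ω.re, w.im + n.2 * ω.im) ∈ E}
      = {n : ℤ × ℤ | w + n.1 + n.2 * ω ∈ angularSector α β R} := by
    ext n
    simp only [Set.mem_ofPred_eq]
    rw [hmem]
    have : (⟨w.re + n.1 + n.2 * ω.re, w.im + n.2 * ω.im⟩ : ℂ) = w + n.1 + n.2 * ω := by
      apply Complex.ext <;> simp
    rw [this]
  rw [hset, hEv] at key
  refine ⟨key.1, ?_⟩
  have hk := key.2
  set N : ℝ := ({n : ℤ × ℤ | w + n.1 + n.2 * ω ∈ angularSector α β R}.ncard : ℝ)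
  have : ω.im * (N - (β - α) * R ^ 2 / (2 * ω.im)) = ω.im * N - (β - α) / 2 * R ^ 2 := by
    field_simp
  rw [← this, abs_mul, abs_of_pos hpos] at hk
  have h5 : 2 * R + ω.im + 2 * R * ω.im ≤ ω.im * (5 * (R + 1)) := by nlinarith
  exact le_of_mul_le_mul_left (hk.trans h5) hpos

/-- The number of points of a translated lattice `w + ℤ + ℤ ω` in an angular sector, with an
error that does not depend on `ω`. -/
lemma count_angularSector {α β : ℝ} (h1 : α < β) (h2 : β - α ≤ 2 * Real.pi) {R : ℝ} (hR : 0 ≤ R)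
    (w ω : ℂ) (hω : 2 / 3 ≤ ω.im) :
    {n : ℤ × ℤ | w + n.1 + n.2 * ω ∈ angularSector α β R}.Finite ∧
      |({n : ℤ × ℤ | w + n.1 + n.2 * ω ∈ angularSector α β R}.ncard : ℝ)
        - (β - α) * R ^ 2 / (2 * ω.im)| ≤ 20 * (R + 1) := by
  have hpi := Real.pi_pos
  -- cutting the sector in two halves doubles the error
  have double : ∀ ℓ B : ℝ, 2 * ℓ ≤ 2 * Real.pi →
      (∀ α β, α < β → β - α ≤ ℓ → {n : ℤ × ℤ | w + n.1 + n.2 * ω ∈ angularSector α β R}.Finite ∧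
      |({n : ℤ × ℤ | w + n.1 + n.2 * ω ∈ angularSector α β R}.ncard : ℝ)
        - (β - α) * R ^ 2 / (2 * ω.im)| ≤ B) →
      ∀ α β, α < β → β - α ≤ 2 * ℓ →
      {n : ℤ × ℤ | w + n.1 + n.2 * ω ∈ angularSector α β R}.Finite ∧
      |({n : ℤ × ℤ | w + n.1 + n.2 * ω ∈ angularSector α β R}.ncard : ℝ)
        - (β - α) * R ^ 2 / (2 * ω.im)| ≤ 2 * B := by
    intro ℓ B hℓ H α β hαβ hle
    obtain ⟨f1, c1⟩ := H α ((α + β) / 2) (by linarith) (by linarith)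
    obtain ⟨f2, c2⟩ := H ((α + β) / 2) β (by linarith) (by linarith)
    have hu : {n : ℤ × ℤ | w + n.1 + n.2 * ω ∈ angularSector α β R}
        = {n : ℤ × ℤ | w + n.1 + n.2 * ω ∈ angularSector α ((α + β) / 2) R} ∪
          {n : ℤ × ℤ | w + n.1 + n.2 * ω ∈ angularSector ((α + β) / 2) β R} := by
      rw [angularSector_eq_union (show α ≤ (α + β) / 2 by linarith) (show (α + β) / 2 ≤ β by linarith)]
      rfl
    have hd : Disjoint {n : ℤ × ℤ | w + n.1 + n.2 * ω ∈ angularSector α ((α + β) / 2) R}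
          {n : ℤ × ℤ | w + n.1 + n.2 * ω ∈ angularSector ((α + β) / 2) β R} := by
      rw [Set.disjoint_left]
      intro n hn hn'
      exact Set.disjoint_left.1 (disjoint_angularSector (by linarith) R) hn hn'
    rw [hu]
    refine ⟨f1.union f2, ?_⟩
    rw [Set.ncard_union_eq hd f1 f2]
    push_cast
    rw [abs_le] at c1 c2 ⊢
    have : (β - α) * R ^ 2 / (2 * ω.im) = ((α + β) / 2 - α) * R ^ 2 / (2 * ω.im)
        + (β - (α + β) / 2) * R ^ 2 / (2 * ω.im) := by ring
    rw [this]
    constructor <;> linarith [c1.1, c1.2, c2.1, c2.2]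
  -- two halvings reduce the angle to at most `π / 2`
  have q := double Real.pi _ (by linarith) (by
    have := double (Real.pi / 2) (5 * (R + 1)) (by linarith) fun α β hab hle =>
      count_angularSector_narrow hab (by linarith) hR w ω hω
    rwa [show 2 * (Real.pi / 2) = Real.pi by ring] at this) α β h1 h2
  refine ⟨q.1, q.2.trans (by linarith)⟩

/-! ### Imaginary quadratic rings of integers as planar lattices -/

section ImaginaryQuadratic

variable {K : Type*} [Field K] [NumberField K]

open NumberField

/-- The unit of the ring of integers of a quadratic field extends to an integral basis. -/
lemma exists_basis_one (hK : Module.finrank ℚ K = 2) :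
    ∃ b : Module.Basis (Fin 2) ℤ (𝓞 K), b 0 = 1 := by
  have hr : Module.finrank ℤ (𝓞 K) = 2 := by rw [RingOfIntegers.rank, hK]
  set b := Module.finBasisOfFinrankEq ℤ (𝓞 K) hr
  have h1 : (1 : 𝓞 K) = b.repr 1 0 • b 0 + b.repr 1 1 • b 1 := by
    conv_lhs => rw [← b.sum_repr 1]
    rw [Fin.sum_univ_two]
  set p := b.repr 1 0
  set q := b.repr 1 1
  -- a common divisor `g` of `p` and `q` would divide `1`, and its norm `g²` would be a unit
  have hcop : IsCoprime p q := by
    rw [Int.isCoprime_iff_gcd_eq_one]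
    obtain ⟨p', hp'⟩ := Int.gcd_dvd_left p q
    obtain ⟨q', hq'⟩ := Int.gcd_dvd_right p q
    have h2 : (1 : 𝓞 K) = ((Int.gcd p q : ℤ) : 𝓞 K) * (p' • b 0 + q' • b 1) := by
      rw [mul_add, ← zsmul_eq_mul, ← zsmul_eq_mul, smul_smul, smul_smul, ← hp', ← hq']
      exact h1
    have h3 := congrArg (fun x => (Algebra.norm ℤ x).natAbs) h2
    simp only [map_one, map_mul, Int.natAbs_mul, Int.natAbs_one] at h3
    have h4 : Algebra.norm ℤ ((Int.gcd p q : ℤ) : 𝓞 K) = (Int.gcd p q : ℤ) ^ 2 := by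
      have := Algebra.norm_algebraMap_of_basis b (Int.gcd p q : ℤ)
      simpa using this
    rw [h4] at h3
    have h5 := Nat.eq_one_of_mul_eq_one_right h3.symm
    rw [Int.natAbs_pow, Int.natAbs_natCast] at h5
    exact Nat.pow_eq_one.1 h5 |>.resolve_right (by norm_num)
  obtain ⟨a, c, hac⟩ := hcop
  set ω := (-c) • b 0 + a • b 1 with hω
  have hli : LinearIndependent ℤ ![(1 : 𝓞 K), ω] := by
    rw [LinearIndependent.pair_iff]
    intro s t hst
    have h2 : (s * p - t * c) • b 0 + (s * q + t * a) • b 1 = 0 := by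
      rw [← hst, hω]
      rw [h1]
      module
    have hb := b.linearIndependent
    have hb' : LinearIndependent ℤ ![b 0, b 1] := by
      convert hb using 1
      ext i; fin_cases i <;> rfl
    obtain ⟨e1, e2⟩ := LinearIndependent.pair_iff.1 hb' _ _ h2
    constructor
    · linear_combination a * e1 + c * e2 - s * hac
    · linear_combination -q * e1 + p * e2 - t * hac
  have hsp : ⊤ ≤ Submodule.span ℤ (Set.range ![(1 : 𝓞 K), ω]) := by
    rw [← b.span_eq, Submodule.span_le]
    have m1 : (1 : 𝓞 K) ∈ Submodule.span ℤ (Set.range ![(1 : 𝓞 K), ω]) :=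
      Submodule.subset_span ⟨0, rfl⟩
    have m2 : ω ∈ Submodule.span ℤ (Set.range ![(1 : 𝓞 K), ω]) :=
      Submodule.subset_span ⟨1, rfl⟩
    rintro _ ⟨i, rfl⟩
    fin_cases i
    · have : b 0 = a • (1 : 𝓞 K) + (-q) • ω := by
        rw [hω]
        rw [h1]
        simp only [smul_add, smul_smul]
        have e : b 0 = (a * p + c * q) • b 0 := by rw [hac, one_smul]
        nth_rw 1 [e]
        module
      simp only [Fin.zero_eta, SetLike.mem_coe]
      rw [this]
      exact add_mem (Submodule.smul_mem _ _ m1) (Submodule.smul_mem _ _ m2)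
    · have : b 1 = c • (1 : 𝓞 K) + p • ω := by
        rw [hω]
        rw [h1]
        simp only [smul_add, smul_smul]
        have e : b 1 = (a * p + c * q) • b 1 := by rw [hac, one_smul]
        nth_rw 1 [e]
        module
      simp only [Fin.mk_one, SetLike.mem_coe]
      rw [this]
      exact add_mem (Submodule.smul_mem _ _ m1) (Submodule.smul_mem _ _ m2)
  exact ⟨Module.Basis.mk hli hsp, by simp⟩

lemma three_le_abs_discr (hK : Module.finrank ℚ K = 2) : (3 : ℝ) ≤ |(discr K : ℝ)| := by
  have := abs_discr_gt_two (K := K) (by rw [hK]; norm_num)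
  have h : (3 : ℤ) ≤ |discr K| := by omega
  exact_mod_cast h

lemma sqrt_abs_discr_ge (hK : Module.finrank ℚ K = 2) : 5 / 3 ≤ Real.sqrt |(discr K : ℝ)| := by
  apply Real.le_sqrt_of_sq_le
  have := three_le_abs_discr hK
  norm_num
  linarith

variable [IsTotallyComplex K]

/-- A quadratic field with a nonreal embedding `σ` has exactly the embeddings `σ` and `conj σ`. -/
lemma univ_embeddings_eq (σ : K →+* ℂ) (hK : Module.finrank ℚ K = 2) [DecidableEq (K →ₐ[ℚ] ℂ)] :
    (Finset.univ : Finset (K →ₐ[ℚ] ℂ)) =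
      {σ.toRatAlgHom, (ComplexEmbedding.conjugate σ).toRatAlgHom} ∧
    σ.toRatAlgHom ≠ (ComplexEmbedding.conjugate σ).toRatAlgHom := by
  have hne : σ.toRatAlgHom ≠ (ComplexEmbedding.conjugate σ).toRatAlgHom := by
    intro h
    have h1 : ComplexEmbedding.IsReal σ := by
      rw [ComplexEmbedding.isReal_iff]
      ext x
      exact (DFunLike.congr_fun h x).symm
    have h2 := IsTotallyComplex.isComplex (InfinitePlace.mk σ)
    rw [← InfinitePlace.not_isReal_iff_isComplex] at h2
    exact h2 (InfinitePlace.isReal_iff.2 (by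
      have := (InfinitePlace.isReal_mk_iff (φ := σ)).2 h1
      exact InfinitePlace.isReal_iff.1 this))
  refine ⟨(Finset.eq_of_subset_of_card_le (Finset.subset_univ _) ?_).symm, hne⟩
  rw [Finset.card_univ, AlgHom.card, hK, Finset.card_pair hne]

lemma trace_eq_two_re (σ : K →+* ℂ) (hK : Module.finrank ℚ K = 2) (a : 𝓞 K) :
    (Algebra.trace ℤ (𝓞 K) a : ℝ) = 2 * (σ a).re := by
  classical
  have h := trace_eq_sum_embeddings (K := ℚ) (L := K) ℂ (x := (a : K))
  obtain ⟨hu, hne⟩ := univ_embeddings_eq σ hK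
  rw [hu, Finset.sum_pair hne] at h
  have h2 : (algebraMap ℚ ℂ) ((Algebra.trace ℚ K) (a : K)) = (Algebra.trace ℤ (𝓞 K) a : ℂ) := by
    rw [← Algebra.coe_trace_int]; simp
  rw [h2] at h
  have h3 := congrArg Complex.re h
  simp at h3
  rw [h3]; ring

lemma intNorm_eq_normSq (σ : K →+* ℂ) (hK : Module.finrank ℚ K = 2) (a : 𝓞 K) :
    (intNorm a : ℝ) = ‖σ a‖ ^ 2 := by
  classical
  have h := Algebra.norm_eq_prod_embeddings ℚ ℂ (a : K)
  obtain ⟨hu, hne⟩ := univ_embeddings_eq σ hK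
  rw [hu, Finset.prod_pair hne] at h
  have h2 : (algebraMap ℚ ℂ) ((Algebra.norm ℚ) (a : K)) = ((Algebra.norm ℤ a : ℝ) : ℂ) := by
    rw [← Algebra.coe_norm_int]; simp
  rw [h2] at h
  have h3 : ((Algebra.norm ℤ a : ℝ) : ℂ) = ((‖σ a‖ ^ 2 : ℝ) : ℂ) := by
    rw [h]
    have := Complex.mul_conj (σ a)
    rw [Complex.normSq_eq_norm_sq] at this
    exact this
  have h4 : (Algebra.norm ℤ a : ℝ) = ‖σ a‖ ^ 2 := by exact_mod_cast h3
  rw [intNorm, Ideal.absNorm_span_singleton, Nat.cast_natAbs, Int.cast_abs, h4, abs_of_nonneg]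
  positivity

/-- The ring of integers of an imaginary quadratic field is a lattice `ℤ + ℤ ω` of `ℂ`, in which
`ω` has imaginary part `√|D| / 2`. -/
lemma exists_generator (σ : K →+* ℂ) (hK : Module.finrank ℚ K = 2) :
    ∃ ω : 𝓞 K, Function.Bijective (fun n : ℤ × ℤ => (n.1 : 𝓞 K) + n.2 * ω) ∧
      (σ ω).im = Real.sqrt |(discr K : ℝ)| / 2 ∧ |(σ ω).re| ≤ 1 / 2 := by
  obtain ⟨b, hb⟩ := exists_basis_one hK
  have hbij : Function.Bijective (fun n : ℤ × ℤ => (n.1 : 𝓞 K) + n.2 * b 1) := by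
    have : (fun n : ℤ × ℤ => (n.1 : 𝓞 K) + n.2 * b 1)
        = b.equivFun.symm ∘ (finTwoArrowEquiv ℤ).symm := by
      ext n
      simp [Module.Basis.equivFun_symm_apply, hb]
    rw [this]
    exact b.equivFun.symm.bijective.comp (finTwoArrowEquiv ℤ).symm.bijective
  have hD : (discr K : ℝ) = -(2 * (σ (b 1)).im) ^ 2 := by
    rw [← discr_eq_discr K b, Algebra.discr_def, Matrix.det_fin_two]
    simp only [Algebra.traceMatrix_apply, Algebra.traceForm_apply, hb, one_mul, mul_one]
    push_cast
    simp only [trace_eq_two_re σ hK]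
    simp
    ring
  have hD' : |2 * (σ (b 1)).im| = Real.sqrt |(discr K : ℝ)| := by
    rw [hD, abs_neg, abs_pow, Real.sqrt_sq (abs_nonneg _)]
  have key : ∀ (ε : ℤ) (hε : ε * ε = 1) (c : ℤ), Function.Bijective
      (fun n : ℤ × ℤ => (n.1 : 𝓞 K) + n.2 * (ε * b 1 + c)) := by
    intro ε hε c
    have hg : Function.Bijective (fun n : ℤ × ℤ => ((n.1 + n.2 * c, n.2 * ε) : ℤ × ℤ)) := by
      refine Function.bijective_iff_has_inverse.2
        ⟨fun n => (n.1 - n.2 * ε * c, n.2 * ε), fun n => ?_, fun n => ?_⟩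
      · ext
        · simp only; linear_combination (-n.2 * c) * hε
        · simp only; linear_combination n.2 * hε
      · ext
        · simp only; ring
        · simp only; linear_combination n.2 * hε
    convert hbij.comp hg using 1
    ext n
    simp only [Function.comp]
    push_cast
    ring_nf
  obtain ⟨ε, hε, him⟩ : ∃ ε : ℤ, ε * ε = 1 ∧ 2 * (ε * (σ (b 1)).im) = |2 * (σ (b 1)).im| := by
    rcases le_total 0 (2 * (σ (b 1)).im) with h | h
    · exact ⟨1, by norm_num, by rw [abs_of_nonneg h]; simp⟩
    · exact ⟨-1, by norm_num, by rw [abs_of_nonpos h]; simp⟩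
  -- subtracting the nearest integer brings the real part into `[-1/2, 1/2]`
  refine ⟨ε * b 1 + (-round (ε * (σ (b 1)).re) : ℤ), key ε hε _, ?_, ?_⟩
  · simp
    linarith
  · have := abs_sub_round (ε * (σ (b 1)).re)
    simp
    rw [← sub_eq_add_neg]
    simpa using this

end ImaginaryQuadratic

/-! ### Points and norms of ideals -/

section Counting

open NumberField

variable {K : Type*} [Field K] [NumberField K] [IsTotallyComplex K]

lemma absNorm_span_eq_normSq (σ : K →+* ℂ) (hK : Module.finrank ℚ K = 2) (a : 𝓞 K) :
    (Ideal.absNorm (Ideal.span {a}) : ℝ) = ‖σ a‖ ^ 2 := intNorm_eq_normSq σ hK a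

lemma one_le_norm (σ : K →+* ℂ) (hK : Module.finrank ℚ K = 2) {a : 𝓞 K} (ha : a ≠ 0) :
    1 ≤ ‖σ a‖ := by
  have h := absNorm_span_eq_normSq σ hK a
  have h1 : 1 ≤ Ideal.absNorm (Ideal.span {a}) := by
    rw [Nat.one_le_iff_ne_zero, Ne, Ideal.absNorm_eq_zero_iff, Ideal.span_singleton_eq_bot]
    exact ha
  have h2 : (1 : ℝ) ≤ ‖σ a‖ ^ 2 := by rw [← h]; exact_mod_cast h1
  nlinarith [norm_nonneg (σ a)]

lemma absNorm_le_of_mem (σ : K →+* ℂ) (hK : Module.finrank ℚ K = 2) {L : Ideal (𝓞 K)}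
    {a : 𝓞 K} (ha : a ≠ 0) (haL : a ∈ L) : (Ideal.absNorm L : ℝ) ≤ ‖σ a‖ ^ 2 := by
  rw [← absNorm_span_eq_normSq σ hK a]
  have h1 : Ideal.absNorm (Ideal.span {a}) ≠ 0 := by
    rw [Ne, Ideal.absNorm_eq_zero_iff, Ideal.span_singleton_eq_bot]
    exact ha
  exact_mod_cast Nat.le_of_dvd (Nat.pos_of_ne_zero h1)
    (Ideal.absNorm_dvd_absNorm_of_le ((Ideal.span_singleton_le_iff_mem _).2 haL))

variable [IsPrincipalIdealRing (𝓞 K)]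

/-- The number of points of a coset of a nonzero ideal in an angular sector. -/
lemma count_coset (σ : K →+* ℂ) (hK : Module.finrank ℚ K = 2) {L : Ideal (𝓞 K)} (hL : L ≠ ⊥)
    (a₀ : 𝓞 K) {α β : ℝ} (h1 : α < β) (h2 : β - α ≤ 2 * Real.pi) {R : ℝ} (hR : 0 ≤ R) :
    {a : 𝓞 K | a - a₀ ∈ L ∧ σ a ∈ angularSector α β R}.Finite ∧
      |({a : 𝓞 K | a - a₀ ∈ L ∧ σ a ∈ angularSector α β R}.ncard : ℝ)
        - (β - α) * R ^ 2 / (Real.sqrt |(discr K : ℝ)| * Ideal.absNorm L)|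
        ≤ 20 * (R / Real.sqrt (Ideal.absNorm L) + 1) := by
  obtain ⟨ω, hbij, him, -⟩ := exists_generator σ hK
  obtain ⟨ℓ, rfl⟩ := (IsPrincipalIdealRing.principal L).principal
  rw [Ideal.submodule_span_eq] at hL ⊢
  have hℓ : ℓ ≠ 0 := by rintro rfl; simp at hL
  have hσℓ : σ ℓ ≠ 0 := by simpa using hℓ
  have hn : 0 < ‖σ ℓ‖ := norm_pos_iff.2 hσℓ
  have hN := absNorm_span_eq_normSq σ hK ℓ
  have hs := sqrt_abs_discr_ge hK
  have key := count_angularSector (α := α - (σ ℓ).arg) (β := β - (σ ℓ).arg) (by linarith)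
    (by linarith) (div_nonneg hR hn.le) (σ a₀ / σ ℓ) (σ ω) (by rw [him]; linarith)
  set A := {n : ℤ × ℤ | σ a₀ / σ ℓ + n.1 + n.2 * σ ω ∈
    angularSector (α - (σ ℓ).arg) (β - (σ ℓ).arg) (R / ‖σ ℓ‖)} with hA
  set g : ℤ × ℤ → 𝓞 K := fun n => a₀ + ℓ * (n.1 + n.2 * ω) with hg
  have hginj : Function.Injective g := by
    intro n n' h
    simp only [hg, add_right_inj] at h
    exact hbij.1 (mul_left_cancel₀ hℓ h)
  have himage : {a : 𝓞 K | a - a₀ ∈ Ideal.span {ℓ} ∧ σ a ∈ angularSector α β R} = g '' A := by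
    have hmem : ∀ n : ℤ × ℤ, n ∈ A ↔ σ (g n) ∈ angularSector α β R := by
      intro n
      have : σ (g n : 𝓞 K) = (σ a₀ / σ ℓ + n.1 + n.2 * σ ω) * σ ℓ := by
        simp only [hg]
        push_cast
        simp only [map_add, map_mul, map_intCast]
        field_simp
        ring
      rw [this, mul_mem_angularSector_iff hσℓ]
      rfl
    ext a
    constructor
    · rintro ⟨ha, ha'⟩
      obtain ⟨c, hc⟩ := Ideal.mem_span_singleton'.1 ha
      obtain ⟨n, hn⟩ := hbij.2 c
      have hga : g n = a := by
        simp only at hn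
        simp only [hg, hn]
        linear_combination hc
      exact ⟨n, (hmem n).2 (hga ▸ ha'), hga⟩
    · rintro ⟨n, hn, rfl⟩
      refine ⟨?_, (hmem n).1 hn⟩
      simp only [hg, add_sub_cancel_left]
      exact Ideal.mul_mem_right _ _ (Ideal.mem_span_singleton_self ℓ)
  rw [himage, Set.ncard_image_of_injective _ hginj, hN, Real.sqrt_sq hn.le]
  refine ⟨key.1.image g, ?_⟩
  convert key.2 using 3
  rw [him]
  field_simp
  ring

lemma mem_angularSector_pi_iff {R : ℝ} {w : ℂ} :
    w ∈ angularSector (-Real.pi) Real.pi R ↔ w ≠ 0 ∧ ‖w‖ ≤ R := by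
  constructor
  · exact fun h => ⟨ne_zero_of_mem_angularSector h, norm_le_of_mem_angularSector h⟩
  · rintro ⟨h, hR⟩
    exact ⟨w.arg, Complex.arg_mem_Ioc w, ‖w‖, ⟨norm_pos_iff.2 h, hR⟩,
      (Complex.norm_mul_exp_arg_mul_I w).symm⟩

/-- An upper bound without error term for the number of nonzero points of an ideal in a disc. -/
lemma count_disc_le (σ : K →+* ℂ) (hK : Module.finrank ℚ K = 2) {L : Ideal (𝓞 K)} (hL : L ≠ ⊥)
    {R : ℝ} (hR : 0 ≤ R) :
    {a : 𝓞 K | a ∈ L ∧ a ≠ 0 ∧ ‖σ a‖ ≤ R}.Finite ∧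
      ({a : 𝓞 K | a ∈ L ∧ a ≠ 0 ∧ ‖σ a‖ ≤ R}.ncard : ℝ) ≤ 60 * R ^ 2 / Ideal.absNorm L := by
  have hpi := Real.pi_pos
  have key := count_coset σ hK hL 0 (α := -Real.pi) (β := Real.pi) (by linarith) (by linarith) hR
  have hset : {a : 𝓞 K | a - 0 ∈ L ∧ σ a ∈ angularSector (-Real.pi) Real.pi R}
      = {a : 𝓞 K | a ∈ L ∧ a ≠ 0 ∧ ‖σ a‖ ≤ R} := by
    ext a
    simp [mem_angularSector_pi_iff]
  rw [hset] at key
  refine ⟨key.1, ?_⟩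
  have hNpos : (0 : ℝ) < Ideal.absNorm L := by
    have : Ideal.absNorm L ≠ 0 := by rwa [Ne, Ideal.absNorm_eq_zero_iff]
    exact_mod_cast Nat.pos_of_ne_zero this
  -- a nonzero element of `L` forces `N(L) ≤ R²`, and then the main term dominates the error
  rcases Set.eq_empty_or_nonempty {a : 𝓞 K | a ∈ L ∧ a ≠ 0 ∧ ‖σ a‖ ≤ R} with he | ⟨a, ha, ha0, haR⟩
  · rw [he]; simp; positivity
  · have hNR : (Ideal.absNorm L : ℝ) ≤ R ^ 2 :=
      (absNorm_le_of_mem σ hK ha0 ha).trans (by gcongr)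
    set N : ℝ := (Ideal.absNorm L : ℝ)
    have hsN : 0 < Real.sqrt N := Real.sqrt_pos.2 hNpos
    have h1 : 1 ≤ R / Real.sqrt N := by
      rw [one_le_div hsN]
      exact Real.sqrt_le_iff.2 ⟨hR, hNR⟩
    have h2 : R ^ 2 / N = (R / Real.sqrt N) ^ 2 := by rw [div_pow, Real.sq_sqrt hNpos.le]
    have h3 : (Real.pi - -Real.pi) * R ^ 2 / (Real.sqrt |(discr K : ℝ)| * N)
        ≤ 4 * (R ^ 2 / N) := by
      have hs := sqrt_abs_discr_ge hK
      rw [show (Real.pi - -Real.pi) * R ^ 2 / (Real.sqrt |(discr K : ℝ)| * N)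
        = (2 * Real.pi / Real.sqrt |(discr K : ℝ)|) * (R ^ 2 / N) by
          have : 0 < Real.sqrt |(discr K : ℝ)| := by linarith
          field_simp; ring]
      gcongr
      rw [div_le_iff₀ (by linarith)]
      have := Real.pi_lt_d2
      linarith
    have h4 := (abs_le.1 key.2).2
    rw [mul_div_assoc]
    rw [h2] at h3 ⊢
    nlinarith

/-- A universal upper bound for the sum of `N(I) ^ (-5/4)` over distinct nonzero principal
ideals of an imaginary quadratic ring of integers. -/
noncomputable def zetaBound : ℝ := 2 ^ (5 / 2 : ℝ) * ∑' x : Fin 2 → ℤ, ‖x‖ ^ (-(5 / 2) : ℝ)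

/-- The sum of `N(I) ^ (-5/4)` is bounded uniformly in the field: a generator of `I` with
coordinates `(u, v)` has absolute value at least `max (|u|, |v|) / 2`. -/
lemma tsum_absNorm_rpow_le (σ : K →+* ℂ) (hK : Module.finrank ℚ K = 2) {ι : Type*}
    (I : ι → Ideal (𝓞 K)) (hinj : Function.Injective I) (h0 : ∀ i, I i ≠ ⊥) :
    Summable (fun i => (Ideal.absNorm (I i) : ℝ) ^ (-(5 / 4) : ℝ)) ∧
      ∑' i, (Ideal.absNorm (I i) : ℝ) ^ (-(5 / 4) : ℝ) ≤ zetaBound := by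
  obtain ⟨ω, hbij, him, hre⟩ := exists_generator σ hK
  have hgen : ∀ i, ∃ n : ℤ × ℤ, I i = Ideal.span {(n.1 : 𝓞 K) + n.2 * ω} := by
    intro i
    obtain ⟨ℓ, hℓ⟩ := (IsPrincipalIdealRing.principal (I i)).principal
    obtain ⟨n, hn⟩ := hbij.2 ℓ
    refine ⟨n, ?_⟩
    simp only at hn
    rw [hn, hℓ, Ideal.submodule_span_eq]
  choose n hn using hgen
  set x : ι → (Fin 2 → ℤ) := fun i => ![(n i).1, (n i).2] with hx
  have hxinj : Function.Injective x := by
    intro i j hij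
    apply hinj
    have e0 : (n i).1 = (n j).1 := congrFun hij 0
    have e1 : (n i).2 = (n j).2 := congrFun hij 1
    rw [hn i, hn j, e0, e1]
  have hsum := EisensteinSeries.summable_one_div_norm_rpow (k := 5 / 2) (by norm_num)
  have hs := sqrt_abs_discr_ge hK
  have hle : ∀ i, (Ideal.absNorm (I i) : ℝ) ^ (-(5 / 4) : ℝ)
      ≤ 2 ^ (5 / 2 : ℝ) * ‖x i‖ ^ (-(5 / 2) : ℝ) := by
    intro i
    set a : 𝓞 K := ((n i).1 : 𝓞 K) + (n i).2 * ω with ha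
    have ha0 : a ≠ 0 := by
      intro h
      apply h0 i
      rw [hn i, ← ha, h]
      simp
    have hN : (Ideal.absNorm (I i) : ℝ) = ‖σ a‖ ^ 2 := by
      rw [hn i, absNorm_span_eq_normSq σ hK]
    have hpos : 0 < ‖σ a‖ := by linarith [one_le_norm σ hK ha0]
    have hσa : σ a = (n i).1 + (n i).2 * σ ω := by
      rw [ha]; push_cast; simp
    have hv : |((n i).2 : ℝ)| * (5 / 6) ≤ ‖σ a‖ := by
      have h1 := Complex.abs_im_le_norm (σ a)
      rw [hσa] at h1
      simp [abs_mul] at h1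
      rw [← hσa] at h1
      refine le_trans ?_ h1
      gcongr
      rw [him]
      exact le_trans (by linarith) (le_abs_self _)
    have hu : |((n i).1 : ℝ)| ≤ ‖σ a‖ + |((n i).2 : ℝ)| * (1 / 2) := by
      have h1 := Complex.abs_re_le_norm (σ a)
      rw [hσa] at h1
      simp at h1
      rw [← hσa] at h1
      have h2 := abs_sub (((n i).1 : ℝ) + (n i).2 * (σ ω).re) ((n i).2 * (σ ω).re)
      rw [add_sub_cancel_right, abs_mul ((n i).2 : ℝ)] at h2
      have h3 : |((n i).2 : ℝ)| * |(σ ω).re| ≤ |((n i).2 : ℝ)| * (1 / 2) := by gcongr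
      linarith
    have hxn : ‖x i‖ ≤ 2 * ‖σ a‖ := by
      rw [pi_norm_le_iff_of_nonneg (by positivity)]
      intro j
      fin_cases j
      · simp only [hx, Fin.zero_eta, Matrix.cons_val_zero, Int.norm_eq_abs]
        linarith
      · simp only [hx, Fin.mk_one, Matrix.cons_val_one, Int.norm_eq_abs]
        simp
        linarith
    have hxpos : 0 < ‖x i‖ := by
      rw [norm_pos_iff]
      intro h
      apply ha0
      have e0 : (n i).1 = 0 := congrFun h 0
      have e1 : (n i).2 = 0 := congrFun h 1
      rw [ha, e0, e1]; simp
    rw [hN, ← Real.rpow_natCast, ← Real.rpow_mul hpos.le]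
    have : (2 : ℝ) ^ (5 / 2 : ℝ) * ‖x i‖ ^ (-(5 / 2) : ℝ) = (‖x i‖ / 2) ^ (-(5 / 2) : ℝ) := by
      rw [Real.div_rpow hxpos.le (by norm_num), Real.rpow_neg (by norm_num : (0 : ℝ) ≤ 2), div_inv_eq_mul,
        mul_comm]
    rw [this]
    norm_num
    exact Real.rpow_le_rpow_of_nonpos (by positivity) (by linarith) (by norm_num)
  have hs1 : Summable fun i => 2 ^ (5 / 2 : ℝ) * ‖x i‖ ^ (-(5 / 2) : ℝ) :=
    (hsum.comp_injective hxinj).mul_left _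
  have hs2 := Summable.of_nonneg_of_le (fun i => by positivity) hle hs1
  refine ⟨hs2, (hs2.tsum_le_tsum hle hs1).trans ?_⟩
  rw [tsum_mul_left, zetaBound]
  gcongr
  exact tsum_comp_le_tsum_of_inj hsum (fun _ => by positivity) hxinj

lemma zetaBound_nonneg : 0 ≤ zetaBound := by unfold zetaBound; positivity

end Counting

/-! ### The Euler function by inclusion-exclusion -/

section EulerPhi

open NumberField IsDedekindDomain

variable {K : Type*} [Field K]

lemma span_ne_bot {a : 𝓞 K} (ha : a ≠ 0) : Ideal.span {a} ≠ ⊥ := by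
  rwa [Ne, Ideal.span_singleton_eq_bot]

/-- The squarefree ideal `∏ p ∈ S, p`. -/
noncomputable def primeProd (S : Finset (HeightOneSpectrum (𝓞 K))) : Ideal (𝓞 K) :=
  ∏ p ∈ S, p.asIdeal

lemma primeProd_ne_bot (S : Finset (HeightOneSpectrum (𝓞 K))) : primeProd S ≠ ⊥ :=
  Finset.prod_ne_zero_iff.2 fun p _ => p.ne_bot

variable [NumberField K]

/-- Divisibility by a product of distinct primes is divisibility by each of them. -/
lemma mem_primeProd {S : Finset (HeightOneSpectrum (𝓞 K))} {a : 𝓞 K} :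
    a ∈ primeProd S ↔ ∀ p ∈ S, a ∈ p.asIdeal := by
  classical
  have hinj : Function.Injective (HeightOneSpectrum.asIdeal (R := 𝓞 K)) :=
    fun p q h => HeightOneSpectrum.ext h
  constructor
  · intro h p hp
    exact Ideal.le_of_dvd (Finset.dvd_prod_of_mem _ hp) h
  · intro h
    have : primeProd S ∣ Ideal.span {a} := by
      have := Finset.prod_primes_dvd (s := S.map ⟨_, hinj⟩) (Ideal.span {a})
        (by simp only [Finset.mem_map, Function.Embedding.coeFn_mk]
            rintro _ ⟨p, -, rfl⟩
            exact p.prime)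
        (by simp only [Finset.mem_map, Function.Embedding.coeFn_mk]
            rintro _ ⟨p, hp, rfl⟩
            rw [Ideal.dvd_span_singleton]
            exact h p hp)
      simpa [primeProd] using this
    exact Ideal.dvd_span_singleton.1 this

lemma primeProd_injective :
    Function.Injective (primeProd : Finset (HeightOneSpectrum (𝓞 K)) → Ideal (𝓞 K)) := by
  have key : ∀ S T : Finset (HeightOneSpectrum (𝓞 K)), primeProd S = primeProd T → S ⊆ T := by
    intro S T h p hp
    have h1 : p.asIdeal ∣ primeProd T := h ▸ Finset.dvd_prod_of_mem _ hp
    obtain ⟨q, hq, hpq⟩ := (Prime.dvd_finsetProd_iff p.prime _).1 h1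
    have : p.asIdeal = q.asIdeal := associated_iff_eq.1 (p.prime.associated_of_dvd q.prime hpq)
    rwa [HeightOneSpectrum.ext this]
  exact fun S T h => (key S T h).antisymm (key T S h.symm)

lemma absNorm_pos {I : Ideal (𝓞 K)} (hI : I ≠ ⊥) : 0 < Ideal.absNorm I :=
  Nat.pos_of_ne_zero fun h => hI (Ideal.absNorm_eq_zero_iff.1 h)

lemma two_le_absNorm (p : HeightOneSpectrum (𝓞 K)) : 2 ≤ Ideal.absNorm p.asIdeal := by
  have h1 := absNorm_pos p.ne_bot
  have h2 : Ideal.absNorm p.asIdeal ≠ 1 := fun h => p.isPrime.ne_top (Ideal.absNorm_eq_one_iff.1 h)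
  omega

lemma absNorm_primeProd (S : Finset (HeightOneSpectrum (𝓞 K))) :
    (Ideal.absNorm (primeProd S) : ℝ) = ∏ p ∈ S, (Ideal.absNorm p.asIdeal : ℝ) := by
  rw [primeProd, map_prod, Nat.cast_prod]

/-- The finite set of prime ideals dividing `I` (empty for `I = 0`). -/
noncomputable def primesDividing (I : Ideal (𝓞 K)) : Finset (HeightOneSpectrum (𝓞 K)) :=
  if hI : I = ⊥ then ∅ else (Ideal.finite_factors hI).toFinset

lemma mem_primesDividing {I : Ideal (𝓞 K)} (hI : I ≠ ⊥) {p : HeightOneSpectrum (𝓞 K)} :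
    p ∈ primesDividing I ↔ I ≤ p.asIdeal := by
  rw [primesDividing, dif_neg hI, Set.Finite.mem_toFinset]
  exact Ideal.dvd_iff_le

/-- A class modulo `I` is invertible when it avoids all prime divisors of `I`. -/
lemma isUnit_mk_iff {I : Ideal (𝓞 K)} (hI : I ≠ ⊥) (a : 𝓞 K) :
    IsUnit (Ideal.Quotient.mk I a) ↔ ∀ p ∈ primesDividing I, a ∉ p.asIdeal := by
  constructor
  · intro h p hp ha
    have hle := (mem_primesDividing hI).1 hp
    have h1 := h.map (Ideal.Quotient.factor hle)
    rw [Ideal.Quotient.factor_mk, Ideal.Quotient.eq_zero_iff_mem.2 ha] at h1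
    have : Nontrivial (𝓞 K ⧸ p.asIdeal) := Ideal.Quotient.nontrivial_iff.2 p.isPrime.ne_top
    exact not_isUnit_zero h1
  · intro h
    by_contra hu
    obtain ⟨M, hM, haM⟩ := exists_max_ideal_of_mem_nonunits hu
    have hle : I ≤ M.comap (Ideal.Quotient.mk I) := by
      intro x hx
      rw [Ideal.mem_comap, Ideal.Quotient.eq_zero_iff_mem.2 hx]
      exact M.zero_mem
    have hprime : (M.comap (Ideal.Quotient.mk I)).IsPrime := Ideal.comap_isPrime _ M
    have hne : M.comap (Ideal.Quotient.mk I) ≠ ⊥ := fun h0 => hI (le_bot_iff.1 (h0 ▸ hle))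
    exact h ⟨_, hprime, hne⟩ ((mem_primesDividing hI).2 hle) haM

/-- The index formula: `J / I` has `N(I) / N(J)` elements. -/
lemma card_map_mk {I J : Ideal (𝓞 K)} (hIJ : I ≤ J) :
    (Nat.card {x : 𝓞 K ⧸ I // x ∈ J.map (Ideal.Quotient.mk I)} : ℝ) * Ideal.absNorm J
      = Ideal.absNorm I := by
  have h1 := Submodule.card_eq_card_quotient_mul_card (J.map (Ideal.Quotient.mk I))
  have h2 := Nat.card_congr (DoubleQuot.quotQuotEquivQuotOfLE hIJ).toEquiv
  rw [Ideal.absNorm_apply, Ideal.absNorm_apply, Submodule.cardQuot_apply, Submodule.cardQuot_apply,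
    ← h2, h1]
  push_cast
  rfl

/-- Inclusion-exclusion over the prime divisors of `I`. -/
lemma idealEulerPhi_eq_sum {I : Ideal (𝓞 K)} (hI : I ≠ ⊥) :
    (idealEulerPhi I : ℝ) = Ideal.absNorm I *
      ∑ S ∈ (primesDividing I).powerset, (-1) ^ S.card / (Ideal.absNorm (primeProd S) : ℝ) := by
  classical
  have hfin : Finite (𝓞 K ⧸ I) := (Ideal.absNorm_ne_zero_iff I).1 (absNorm_pos hI).ne'
  have := Fintype.ofFinite (𝓞 K ⧸ I)
  have hmem : ∀ (J : Ideal (𝓞 K)) (_ : I ≤ J) (a : 𝓞 K),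
      Ideal.Quotient.mk I a ∈ J.map (Ideal.Quotient.mk I) ↔ a ∈ J := by
    intro J hJ a
    rw [Ideal.mem_quotient_iff_mem hJ]
  have hle : ∀ S ⊆ primesDividing I, I ≤ primeProd S := fun S hS a ha =>
    mem_primeProd.2 fun p hp => (mem_primesDividing hI).1 (hS hp) ha
  -- the indicator function of the units, expanded
  have h1 : ∀ x : 𝓞 K ⧸ I, (if IsUnit x then (1 : ℝ) else 0) =
      ∑ S ∈ (primesDividing I).powerset, (-1) ^ S.card *
        (if x ∈ (primeProd S).map (Ideal.Quotient.mk I) then (1 : ℝ) else 0) := by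
    intro x
    obtain ⟨a, rfl⟩ := Ideal.Quotient.mk_surjective x
    have e1 : (if IsUnit (Ideal.Quotient.mk I a) then (1 : ℝ) else 0)
        = ∏ p ∈ primesDividing I, ((1 : ℝ) - if a ∈ p.asIdeal then 1 else 0) := by
      split_ifs with hu
      · rw [isUnit_mk_iff hI] at hu
        rw [Finset.prod_eq_one]
        intro p hp
        simp [hu p hp]
      · rw [isUnit_mk_iff hI] at hu
        push Not at hu
        obtain ⟨p, hp, hap⟩ := hu
        rw [Finset.prod_eq_zero hp]
        simp [hap]
    rw [e1, Finset.prod_sub]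
    refine Finset.sum_congr rfl fun S hS => ?_
    rw [Finset.mem_powerset] at hS
    rw [Finset.prod_const_one, mul_one, Finset.prod_boole]
    congr 2
    rw [hmem _ (hle S hS), mem_primeProd]
  have h2 : (idealEulerPhi I : ℝ) = ∑ x : 𝓞 K ⧸ I, if IsUnit x then (1 : ℝ) else 0 := by
    rw [Finset.sum_boole, idealEulerPhi, ← Fintype.card_subtype, ← Nat.card_eq_fintype_card]
    exact congrArg _ (Nat.card_congr Submonoid.unitsTypeEquivIsUnitSubmonoid.toEquiv)
  rw [h2, Finset.sum_congr rfl fun x _ => h1 x, Finset.sum_comm, Finset.mul_sum]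
  refine Finset.sum_congr rfl fun S hS => ?_
  rw [Finset.mem_powerset] at hS
  rw [← Finset.mul_sum, Finset.sum_boole, ← Fintype.card_subtype, ← Nat.card_eq_fintype_card,
    ← card_map_mk (hle S hS)]
  have : (Ideal.absNorm (primeProd S) : ℝ) ≠ 0 := by
    exact_mod_cast (absNorm_pos (primeProd_ne_bot S)).ne'
  field_simp

lemma idealEulerPhi_eq_prod {I : Ideal (𝓞 K)} (hI : I ≠ ⊥) :
    (idealEulerPhi I : ℝ) = Ideal.absNorm I *
      ∏ p ∈ primesDividing I, (1 - 1 / (Ideal.absNorm p.asIdeal : ℝ)) := by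
  classical
  rw [idealEulerPhi_eq_sum hI, Finset.prod_sub]
  congr 1
  refine Finset.sum_congr rfl fun S _ => ?_
  rw [absNorm_primeProd, Finset.prod_const_one, mul_one, Finset.prod_div_distrib,
    Finset.prod_const_one, mul_one_div]

/-- The proportion `φ(a) / N(a)` of invertible classes modulo `a`. -/
noncomputable def phiRatio (a : 𝓞 K) : ℝ := (eulerPhi a : ℝ) / intNorm a

lemma intNorm_pos {a : 𝓞 K} (ha : a ≠ 0) : 0 < (intNorm a : ℝ) := by
  exact_mod_cast absNorm_pos (span_ne_bot ha)

lemma eulerPhi_eq_mul_phiRatio {a : 𝓞 K} (ha : a ≠ 0) :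
    (eulerPhi a : ℝ) = phiRatio a * intNorm a := by
  rw [phiRatio, div_mul_cancel₀ _ (intNorm_pos ha).ne']

lemma phiRatio_eq_prod {a : 𝓞 K} (ha : a ≠ 0) :
    phiRatio a = ∏ p ∈ primesDividing (Ideal.span {a}),
      (1 - 1 / (Ideal.absNorm p.asIdeal : ℝ)) := by
  have h := idealEulerPhi_eq_prod (span_ne_bot ha)
  have hp := intNorm_pos ha
  rw [phiRatio, eulerPhi, h, intNorm]
  rw [intNorm] at hp
  field_simp

lemma mem_primesDividing_span {a : 𝓞 K} (ha : a ≠ 0) {p : HeightOneSpectrum (𝓞 K)} :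
    p ∈ primesDividing (Ideal.span {a}) ↔ a ∈ p.asIdeal := by
  rw [mem_primesDividing (span_ne_bot ha), Ideal.span_singleton_le_iff_mem]

/-- The weight `μ(I) / N(I)` of the squarefree ideal `I = ∏ p ∈ S, p`. -/
noncomputable def moebiusWeight (S : Finset (HeightOneSpectrum (𝓞 K))) : ℝ :=
  (-1) ^ S.card / (Ideal.absNorm (primeProd S) : ℝ)

lemma abs_moebiusWeight (S : Finset (HeightOneSpectrum (𝓞 K))) :
    |moebiusWeight S| = 1 / (Ideal.absNorm (primeProd S) : ℝ) := by
  rw [moebiusWeight, abs_div, abs_pow, abs_neg, abs_one, one_pow, Nat.abs_cast]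

open Classical in
/-- The expansion of `φ(a) / N(a)` over the squarefree divisors of `a`, as a sum over any finite
set `F` containing them all, so that one `F` can serve for several `a`. -/
lemma phiRatio_eq_sum {a : 𝓞 K} (ha : a ≠ 0) {F : Finset (Finset (HeightOneSpectrum (𝓞 K)))}
    (hF : ∀ S, a ∈ primeProd S → S ∈ F) :
    phiRatio a = ∑ S ∈ F, if a ∈ primeProd S then moebiusWeight S else 0 := by
  have h := idealEulerPhi_eq_sum (span_ne_bot ha)
  have hp := intNorm_pos ha
  rw [phiRatio, eulerPhi, h, intNorm]
  rw [intNorm] at hp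
  rw [mul_div_cancel_left₀ _ hp.ne', ← Finset.sum_filter]
  refine Finset.sum_congr ?_ fun S _ => rfl
  ext S
  have : S ∈ (primesDividing (Ideal.span {a})).powerset ↔ a ∈ primeProd S := by
    rw [Finset.mem_powerset, mem_primeProd]
    exact forall₂_congr fun p _ => mem_primesDividing_span ha
  rw [this, Finset.mem_filter]
  exact ⟨fun h => ⟨hF S h, h⟩, fun h => h.2⟩

lemma phiRatio_nonneg (a : 𝓞 K) : 0 ≤ phiRatio a := by unfold phiRatio; positivity

lemma one_div_absNorm_le_half (p : HeightOneSpectrum (𝓞 K)) :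
    1 / (Ideal.absNorm p.asIdeal : ℝ) ≤ 1 / 2 := by
  have : (2 : ℝ) ≤ Ideal.absNorm p.asIdeal := by exact_mod_cast two_le_absNorm p
  gcongr

lemma phiRatio_le_one {a : 𝓞 K} (ha : a ≠ 0) : phiRatio a ≤ 1 := by
  rw [phiRatio_eq_prod ha]
  refine Finset.prod_le_one (fun p _ => ?_) (fun p _ => ?_)
  · linarith [one_div_absNorm_le_half p]
  · have : (0 : ℝ) ≤ 1 / (Ideal.absNorm p.asIdeal : ℝ) := by positivity
    linarith

lemma exp_neg_two_mul_le {t : ℝ} (h0 : 0 ≤ t) (h1 : t ≤ 1 / 2) : Real.exp (-2 * t) ≤ 1 - t := by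
  rw [show -2 * t = -(2 * t) by ring, Real.exp_neg]
  have h2 := Real.quadratic_le_exp_of_nonneg (x := 2 * t) (by linarith)
  rw [inv_le_comm₀ (Real.exp_pos _) (by linarith)]
  refine le_trans ?_ h2
  rw [inv_le_iff_one_le_mul₀ (by linarith)]
  nlinarith [mul_nonneg h0 h0, mul_nonneg h0 (sub_nonneg.2 h1)]

/-- A lower bound for `φ(a) / N(a)` whose logarithm can be averaged over `a`. -/
lemma exp_le_phiRatio {a : 𝓞 K} (ha : a ≠ 0) :
    Real.exp (-2 * ∑ p ∈ primesDividing (Ideal.span {a}), 1 / (Ideal.absNorm p.asIdeal : ℝ))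
      ≤ phiRatio a := by
  rw [phiRatio_eq_prod ha, Finset.mul_sum, Real.exp_sum]
  exact Finset.prod_le_prod (fun _ _ => (Real.exp_pos _).le) fun p _ =>
    exp_neg_two_mul_le (by positivity) (one_div_absNorm_le_half p)

end EulerPhi

/-! ### Pairs of squarefree divisors and the asymptotic density -/

section Density

open NumberField IsDedekindDomain

variable {K : Type*} [Field K]

/-- The points of `m`, other than `-k`, in an angular sector. -/
def admissible (σ : K →+* ℂ) (m : Ideal (𝓞 K)) (k : 𝓞 K) (α β r : ℝ) : Set (𝓞 K) :=
  {a | a ∈ m ∧ σ a ∈ angularSector α β r ∧ a + k ≠ 0}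

lemma ne_zero_of_mem_admissible {σ : K →+* ℂ} {m : Ideal (𝓞 K)} {k : 𝓞 K} {α β r : ℝ} {a : 𝓞 K}
    (ha : a ∈ admissible σ m k α β r) : a ≠ 0 := by
  rintro rfl
  exact ne_zero_of_mem_angularSector ha.2.1 (by simp)

lemma norm_add_le_of_mem_admissible {σ : K →+* ℂ} {m : Ideal (𝓞 K)} {k : 𝓞 K} {α β r : ℝ}
    {a : 𝓞 K} (ha : a ∈ admissible σ m k α β r) (hk : ‖σ k‖ ≤ r) : ‖σ (a + k : 𝓞 K)‖ ≤ 2 * r := by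
  have h1 := norm_le_of_mem_angularSector ha.2.1
  push_cast
  rw [map_add]
  linarith [norm_add_le (σ a) (σ k)]

lemma inf_primeProd_ne_bot {m : Ideal (𝓞 K)} (hm : m ≠ ⊥)
    (S T : Finset (HeightOneSpectrum (𝓞 K))) : m ⊓ primeProd S ⊓ primeProd T ≠ ⊥ := by
  have h : m * primeProd S * primeProd T ≠ ⊥ :=
    mul_ne_zero (mul_ne_zero hm (primeProd_ne_bot S)) (primeProd_ne_bot T)
  intro h0
  exact h (le_bot_iff.1 (h0 ▸ Ideal.mul_le_inf.trans (inf_le_inf_right _ Ideal.mul_le_inf)))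

variable [NumberField K]

/-- The sum of `φ(a) φ(a + k) / (N(a) N(a + k))` over the points of `m` in an angular sector. -/
noncomputable def ratioSum (σ : K →+* ℂ) (m : Ideal (𝓞 K)) (k : 𝓞 K) (α β r : ℝ) : ℝ :=
  ∑ᶠ a ∈ admissible σ m k α β r, phiRatio a * phiRatio (a + k)

open Classical in
/-- The density, relative to `𝓞 K`, of the set of all `a ∈ m` such that `∏ p ∈ S, p` divides `a`
and `∏ p ∈ T, p` divides `a + k`; this set is empty or a coset of an ideal. -/
noncomputable def cosetDensity (m : Ideal (𝓞 K)) (k : 𝓞 K)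
    (S T : Finset (HeightOneSpectrum (𝓞 K))) : ℝ :=
  if ∃ a, a ∈ m ∧ a ∈ primeProd S ∧ a + k ∈ primeProd T then
    1 / (Ideal.absNorm (m ⊓ primeProd S ⊓ primeProd T) : ℝ) else 0

/-- The constant `c_{m,k}`, as a double sum over squarefree ideals. -/
noncomputable def densityConst (m : Ideal (𝓞 K)) (k : 𝓞 K) : ℝ :=
  ∑' P : Finset (HeightOneSpectrum (𝓞 K)) × Finset (HeightOneSpectrum (𝓞 K)),
    moebiusWeight P.1 * moebiusWeight P.2 * cosetDensity m k P.1 P.2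

lemma absNorm_le_of_le {I J : Ideal (𝓞 K)} (hI : I ≠ ⊥) (h : I ≤ J) :
    (Ideal.absNorm J : ℝ) ≤ Ideal.absNorm I := by
  exact_mod_cast Nat.le_of_dvd (absNorm_pos hI) (Ideal.absNorm_dvd_absNorm_of_le h)

lemma one_le_absNorm {I : Ideal (𝓞 K)} (hI : I ≠ ⊥) : (1 : ℝ) ≤ Ideal.absNorm I := by
  exact_mod_cast absNorm_pos hI

/-- The fourth root `q` of `N(S) N(T)`, which is at most the square root of `N(m ∩ S ∩ T)`. -/
lemma exists_fourth_root {m : Ideal (𝓞 K)} (hm : m ≠ ⊥)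
    (S T : Finset (HeightOneSpectrum (𝓞 K))) :
    ∃ q : ℝ, 1 ≤ q ∧ q ^ 4 = (Ideal.absNorm (primeProd S) : ℝ) * Ideal.absNorm (primeProd T) ∧
      q ^ 2 ≤ Ideal.absNorm (m ⊓ primeProd S ⊓ primeProd T) ∧
      1 / (Ideal.absNorm (primeProd S) : ℝ) * (1 / (Ideal.absNorm (primeProd T) : ℝ)) * (1 / q)
        = (Ideal.absNorm (primeProd S) : ℝ) ^ (-(5 / 4) : ℝ) *
          (Ideal.absNorm (primeProd T) : ℝ) ^ (-(5 / 4) : ℝ) := by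
  have hL := inf_primeProd_ne_bot hm S T
  have h1 := absNorm_le_of_le hL (inf_le_left.trans inf_le_right : _ ≤ primeProd S)
  have h2 := absNorm_le_of_le hL (inf_le_right : _ ≤ primeProd T)
  have hS := one_le_absNorm (primeProd_ne_bot S)
  have hT := one_le_absNorm (primeProd_ne_bot T)
  set a : ℝ := (Ideal.absNorm (primeProd S) : ℝ)
  set b : ℝ := (Ideal.absNorm (primeProd T) : ℝ)
  set n : ℝ := (Ideal.absNorm (m ⊓ primeProd S ⊓ primeProd T) : ℝ)
  have hab : 1 ≤ a * b := by nlinarith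
  have hq4 : ((a * b) ^ (1 / 4 : ℝ)) ^ 4 = a * b := by
    rw [← Real.rpow_natCast, ← Real.rpow_mul (by linarith)]
    norm_num
  refine ⟨(a * b) ^ (1 / 4 : ℝ), Real.one_le_rpow hab (by norm_num), hq4, ?_, ?_⟩
  · have h3 : (((a * b) ^ (1 / 4 : ℝ)) ^ 2) ^ 2 ≤ n ^ 2 := by
      rw [← pow_mul, hq4]; nlinarith
    exact le_of_pow_le_pow_left₀ two_ne_zero (by linarith) h3
  · rw [← Real.mul_rpow (by linarith) (by linarith), show (-(5 / 4) : ℝ) = -1 + -(1 / 4) by norm_num,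
      Real.rpow_add (by linarith), Real.rpow_neg_one, Real.rpow_neg (by linarith)]
    field_simp

lemma cosetDensity_nonneg (m : Ideal (𝓞 K)) (k : 𝓞 K)
    (S T : Finset (HeightOneSpectrum (𝓞 K))) : 0 ≤ cosetDensity m k S T := by
  unfold cosetDensity; split_ifs <;> positivity

lemma cosetDensity_le (m : Ideal (𝓞 K)) (k : 𝓞 K)
    (S T : Finset (HeightOneSpectrum (𝓞 K))) :
    cosetDensity m k S T ≤ 1 / (Ideal.absNorm (m ⊓ primeProd S ⊓ primeProd T) : ℝ) := by
  unfold cosetDensity; split_ifs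
  · exact le_rfl
  · positivity

lemma main_coeff_le (hK : Module.finrank ℚ K = 2) {α β : ℝ} (h2 : β - α ≤ 2 * Real.pi) :
    (β - α) / Real.sqrt |(discr K : ℝ)| ≤ 4 := by
  have := sqrt_abs_discr_ge hK
  rw [div_le_iff₀ (by linarith)]
  have := Real.pi_lt_d2
  linarith

variable [IsTotallyComplex K] [IsPrincipalIdealRing (𝓞 K)]

lemma admissible_finite (σ : K →+* ℂ) (hK : Module.finrank ℚ K = 2) {m : Ideal (𝓞 K)}
    (hm : m ≠ ⊥) (k : 𝓞 K) (α β : ℝ) {r : ℝ} (hr : 0 ≤ r) :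
    (admissible σ m k α β r).Finite ∧
      ((admissible σ m k α β r).ncard : ℝ) ≤ 60 * r ^ 2 := by
  obtain ⟨h1, h2⟩ := count_disc_le σ hK hm hr
  have hsub : admissible σ m k α β r ⊆ {a : 𝓞 K | a ∈ m ∧ a ≠ 0 ∧ ‖σ a‖ ≤ r} := fun a ha =>
    ⟨ha.1, ne_zero_of_mem_admissible ha, norm_le_of_mem_angularSector ha.2.1⟩
  refine ⟨h1.subset hsub, ?_⟩
  have h3 : ((admissible σ m k α β r).ncard : ℝ)
      ≤ {a : 𝓞 K | a ∈ m ∧ a ≠ 0 ∧ ‖σ a‖ ≤ r}.ncard := by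
    exact_mod_cast Set.ncard_le_ncard hsub h1
  exact (h3.trans h2).trans (div_le_self (by positivity) (one_le_absNorm hm))

/-- Counting the points of a sector with prescribed divisors of `a` and `a + k`. -/
lemma count_divisible (σ : K →+* ℂ) (hK : Module.finrank ℚ K = 2) {m : Ideal (𝓞 K)} (hm : m ≠ ⊥)
    (k : 𝓞 K) {α β : ℝ} (h1 : α < β) (h2 : β - α ≤ 2 * Real.pi) {r : ℝ} (hr : 0 ≤ r)
    (S T : Finset (HeightOneSpectrum (𝓞 K))) :
    |({a ∈ admissible σ m k α β r | a ∈ primeProd S ∧ a + k ∈ primeProd T}.ncard : ℝ)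
      - (β - α) * r ^ 2 / Real.sqrt |(discr K : ℝ)| * cosetDensity m k S T|
      ≤ 20 * (r / Real.sqrt (Ideal.absNorm (m ⊓ primeProd S ⊓ primeProd T)) + 1) + 1 := by
  set L := m ⊓ primeProd S ⊓ primeProd T with hLdef
  set A := {a ∈ admissible σ m k α β r | a ∈ primeProd S ∧ a + k ∈ primeProd T} with hA
  by_cases hex : ∃ a, a ∈ m ∧ a ∈ primeProd S ∧ a + k ∈ primeProd T
  · obtain ⟨a₀, ha₀m, ha₀S, ha₀T⟩ := hex
    rw [cosetDensity, if_pos ⟨a₀, ha₀m, ha₀S, ha₀T⟩]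
    obtain ⟨hf, hc⟩ := count_coset σ hK (inf_primeProd_ne_bot hm S T) a₀ h1 h2 hr
    rw [← hLdef] at hf hc ⊢
    set B := {a : 𝓞 K | a - a₀ ∈ L ∧ σ a ∈ angularSector α β r} with hB
    have hiff : ∀ a : 𝓞 K, a - a₀ ∈ L ↔ a ∈ m ∧ a ∈ primeProd S ∧ a + k ∈ primeProd T := by
      intro a
      have hsub : ∀ (I : Ideal (𝓞 K)) {x y : 𝓞 K}, y ∈ I → (x - y ∈ I ↔ x ∈ I) := fun I x y hy =>
        ⟨fun h => by simpa using I.add_mem h hy, fun h => I.sub_mem h hy⟩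
      rw [hLdef, Ideal.mem_inf, Ideal.mem_inf, hsub m ha₀m, hsub _ ha₀S,
        ← hsub _ ha₀T (x := a + k), add_sub_add_right_eq_sub, and_assoc]
    have hAB : A ⊆ B := fun a ha => ⟨(hiff a).2 ⟨ha.1.1, ha.2⟩, ha.1.2.1⟩
    have hBA : B \ {-k} ⊆ A := by
      rintro a ⟨ha, hak⟩
      have := (hiff a).1 ha.1
      exact ⟨⟨this.1, ha.2, fun h => hak (eq_neg_of_add_eq_zero_left h)⟩, this.2⟩
    have c1 : (A.ncard : ℝ) ≤ B.ncard := by exact_mod_cast Set.ncard_le_ncard hAB hf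
    have c2 : (B.ncard : ℝ) ≤ A.ncard + 1 := by
      have h3 := Set.ncard_le_ncard hBA (hf.subset hAB)
      have h4 := Set.ncard_le_ncard_sdiff_add_ncard B {-k} (Set.finite_singleton _)
      rw [Set.ncard_singleton] at h4
      exact_mod_cast h4.trans (by omega)
    rw [div_mul_div_comm, mul_one]
    rw [abs_le] at hc ⊢
    constructor <;> linarith [hc.1, hc.2]
  · rw [cosetDensity, if_neg hex]
    have : A = ∅ := by
      ext a
      simp only [Set.mem_empty_iff_false, iff_false]
      exact fun ha => hex ⟨a, ha.1.1, ha.2⟩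
    rw [this]
    simp
    positivity

/-- The preceding estimate, with an error that is summable over `S` and `T` against the weights
`1 / (N(S) N(T))`. -/
lemma count_divisible_summable (σ : K →+* ℂ) (hK : Module.finrank ℚ K = 2) {m : Ideal (𝓞 K)}
    (hm : m ≠ ⊥) (k : 𝓞 K) {α β : ℝ} (h1 : α < β) (h2 : β - α ≤ 2 * Real.pi) {r : ℝ} (hr : 0 < r)
    (hk : ‖σ k‖ ≤ r) (S T : Finset (HeightOneSpectrum (𝓞 K))) :
    |moebiusWeight S * moebiusWeight T *
      ({a ∈ admissible σ m k α β r | a ∈ primeProd S ∧ a + k ∈ primeProd T}.ncard : ℝ)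
      - (β - α) * r ^ 2 / Real.sqrt |(discr K : ℝ)| *
        (moebiusWeight S * moebiusWeight T * cosetDensity m k S T)|
      ≤ 62 * r * ((Ideal.absNorm (primeProd S) : ℝ) ^ (-(5 / 4) : ℝ) *
          (Ideal.absNorm (primeProd T) : ℝ) ^ (-(5 / 4) : ℝ)) := by
  obtain ⟨q, hq1, hq4, hqL, hq⟩ := exists_fourth_root hm S T
  have hc := count_divisible σ hK hm k h1 h2 hr.le S T
  have hq0 : 0 < q := by linarith
  have hsqrt : q ≤ Real.sqrt (Ideal.absNorm (m ⊓ primeProd S ⊓ primeProd T)) :=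
    Real.le_sqrt_of_sq_le hqL
  have hδ0 := cosetDensity_nonneg m k S T
  have hδ := cosetDensity_le m k S T
  have hL := inf_primeProd_ne_bot hm S T
  have hLS := absNorm_le_of_le hL (inf_le_left.trans inf_le_right : _ ≤ primeProd S)
  have hLT := absNorm_le_of_le hL (inf_le_right : _ ≤ primeProd T)
  have hcoef := main_coeff_le hK h2
  have hs := sqrt_abs_discr_ge hK
  set NS : ℝ := (Ideal.absNorm (primeProd S) : ℝ)
  set NT : ℝ := (Ideal.absNorm (primeProd T) : ℝ)
  set NL : ℝ := (Ideal.absNorm (m ⊓ primeProd S ⊓ primeProd T) : ℝ)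
  set A := {a ∈ admissible σ m k α β r | a ∈ primeProd S ∧ a + k ∈ primeProd T}
  set κ := (β - α) / Real.sqrt |(discr K : ℝ)| with hκ
  have hκ0 : 0 ≤ κ := div_nonneg (by linarith) (by linarith)
  set δ := cosetDensity m k S T
  have hNS0 : 0 ≤ NS := by positivity
  have hNT0 : 0 ≤ NT := by positivity
  have hmain : (β - α) * r ^ 2 / Real.sqrt |(discr K : ℝ)| = κ * r ^ 2 := by rw [hκ]; ring
  rw [hmain] at hc ⊢
  have hrq : 0 ≤ r / q := by positivity
  have key : |(A.ncard : ℝ) - κ * r ^ 2 * δ| ≤ 62 * (r / q) := by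
    by_cases hcase : NS ≤ 4 * r ^ 2 ∧ NT ≤ 4 * r ^ 2
    -- for small norms `q ≤ 2 r`, so that the constant error terms are also `O(r / q)`
    · have h5 : q ≤ 2 * r := by
        have : q ^ 4 ≤ (2 * r) ^ 4 := by
          rw [hq4]
          calc NS * NT ≤ (4 * r ^ 2) * (4 * r ^ 2) := by gcongr; exacts [hcase.1, hcase.2]
            _ = _ := by ring
        exact le_of_pow_le_pow_left₀ (by norm_num) (by linarith) this
      have h6 : 1 ≤ 2 * (r / q) := by
        rw [← mul_div_assoc, one_le_div hq0]; exact h5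
      have h7 : r / Real.sqrt NL ≤ r / q := by gcongr
      linarith
    -- otherwise no point is counted, and the main term is small because `N(m ∩ S ∩ T) ≥ 2 r q`
    · have hempty : A = ∅ := by
        ext a
        simp only [Set.mem_empty_iff_false, iff_false]
        intro ha
        apply hcase
        have hn := norm_le_of_mem_angularSector ha.1.2.1
        have hS := absNorm_le_of_mem σ hK (ne_zero_of_mem_admissible ha.1) ha.2.1
        have hT := absNorm_le_of_mem σ hK ha.1.2.2 ha.2.2
        have hn2 := norm_add_le_of_mem_admissible ha.1 hk
        constructor
        · calc NS ≤ _ := hS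
            _ ≤ r ^ 2 := by gcongr
            _ ≤ _ := by nlinarith
        · calc NT ≤ _ := hT
            _ ≤ (2 * r) ^ 2 := by gcongr
            _ = _ := by ring
      have hNL : 4 * r ^ 2 ≤ NL := by
        by_contra! h
        exact hcase ⟨by linarith, by linarith⟩
      have hNL' : 2 * r * q ≤ NL := by
        have : (2 * r * q) ^ 2 ≤ NL ^ 2 := by
          calc (2 * r * q) ^ 2 = (4 * r ^ 2) * q ^ 2 := by ring
            _ ≤ NL * NL := by gcongr
            _ = _ := by ring
        exact le_of_pow_le_pow_left₀ two_ne_zero (by positivity) this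
      have h8 : κ * r ^ 2 * δ ≤ 4 * r ^ 2 * (1 / (2 * r * q)) := by
        gcongr
        exact hδ.trans (by gcongr)
      have h9 : 4 * r ^ 2 * (1 / (2 * r * q)) = 2 * (r / q) := by field_simp; norm_num
      rw [hempty, Set.ncard_empty, Nat.cast_zero, zero_sub, abs_neg, abs_of_nonneg (by positivity)]
      linarith
  have : moebiusWeight S * moebiusWeight T * (A.ncard : ℝ)
      - κ * r ^ 2 * (moebiusWeight S * moebiusWeight T * δ)
      = moebiusWeight S * moebiusWeight T * ((A.ncard : ℝ) - κ * r ^ 2 * δ) := by ring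
  rw [this, abs_mul, abs_mul, abs_moebiusWeight, abs_moebiusWeight, ← hq]
  calc 1 / NS * (1 / NT) * |(A.ncard : ℝ) - κ * r ^ 2 * δ| ≤ 1 / NS * (1 / NT) * (62 * (r / q)) := by
        gcongr
    _ = _ := by ring

/-- The double sum of the error terms is bounded uniformly in the field. -/
lemma summable_absNorm_prod (σ : K →+* ℂ) (hK : Module.finrank ℚ K = 2) :
    Summable (fun P : Finset (HeightOneSpectrum (𝓞 K)) × Finset (HeightOneSpectrum (𝓞 K)) =>
      (Ideal.absNorm (primeProd P.1) : ℝ) ^ (-(5 / 4) : ℝ) *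
          (Ideal.absNorm (primeProd P.2) : ℝ) ^ (-(5 / 4) : ℝ)) ∧
    ∑' P : Finset (HeightOneSpectrum (𝓞 K)) × Finset (HeightOneSpectrum (𝓞 K)),
      (Ideal.absNorm (primeProd P.1) : ℝ) ^ (-(5 / 4) : ℝ) *
          (Ideal.absNorm (primeProd P.2) : ℝ) ^ (-(5 / 4) : ℝ) ≤ zetaBound ^ 2 := by
  obtain ⟨hs, hb⟩ := tsum_absNorm_rpow_le σ hK primeProd primeProd_injective primeProd_ne_bot
  have hp := hs.mul_of_nonneg hs (fun _ => by positivity) (fun _ => by positivity)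
  refine ⟨hp, ?_⟩
  rw [← hs.tsum_mul_tsum hs hp, sq]
  exact mul_le_mul hb hb (tsum_nonneg fun _ => by positivity) zetaBound_nonneg

lemma summable_densityConst (σ : K →+* ℂ) (hK : Module.finrank ℚ K = 2) {m : Ideal (𝓞 K)}
    (hm : m ≠ ⊥) (k : 𝓞 K) :
    Summable (fun P : Finset (HeightOneSpectrum (𝓞 K)) × Finset (HeightOneSpectrum (𝓞 K)) =>
      moebiusWeight P.1 * moebiusWeight P.2 * cosetDensity m k P.1 P.2) := by
  refine Summable.of_norm_bounded (summable_absNorm_prod σ hK).1 ?_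
  rintro ⟨S, T⟩
  obtain ⟨q, hq1, hq4, hqL, hq⟩ := exists_fourth_root hm S T
  rw [Real.norm_eq_abs, abs_mul, abs_mul, abs_moebiusWeight, abs_moebiusWeight, ← hq,
    abs_of_nonneg (cosetDensity_nonneg m k S T)]
  have : cosetDensity m k S T ≤ 1 / q := by
    refine (cosetDensity_le m k S T).trans ?_
    gcongr
    nlinarith
  gcongr

/-- The asymptotic behaviour of `ratioSum` for `r ≥ |k|`. -/
lemma ratioSum_asymptotic (σ : K →+* ℂ) (hK : Module.finrank ℚ K = 2) {m : Ideal (𝓞 K)}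
    (hm : m ≠ ⊥) (k : 𝓞 K) {α β : ℝ} (h1 : α < β) (h2 : β - α ≤ 2 * Real.pi) {r : ℝ} (hr : 0 < r)
    (hk : ‖σ k‖ ≤ r) :
    |ratioSum σ m k α β r - (β - α) * r ^ 2 / Real.sqrt |(discr K : ℝ)| * densityConst m k|
      ≤ 62 * zetaBound ^ 2 * r := by
  classical
  obtain ⟨hfin, -⟩ := admissible_finite σ hK hm k α β hr.le
  set M := hfin.toFinset with hM
  have hMmem : ∀ a, a ∈ M ↔ a ∈ admissible σ m k α β r := fun a => hfin.mem_toFinset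
  -- a finite set of squarefree ideals containing all divisors that occur
  have hFfin : {S : Finset (HeightOneSpectrum (𝓞 K)) |
      ∃ a ∈ M, a ∈ primeProd S ∨ a + k ∈ primeProd S}.Finite := by
    have : {S : Finset (HeightOneSpectrum (𝓞 K)) |
      ∃ a ∈ M, a ∈ primeProd S ∨ a + k ∈ primeProd S} ⊆ ⋃ a ∈ M,
        (((primesDividing (Ideal.span {a})).powerset ∪
          (primesDividing (Ideal.span {a + k})).powerset :
          Finset (Finset (HeightOneSpectrum (𝓞 K)))) : Set _) := by
      rintro S ⟨a, ha, h⟩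
      simp only [Set.mem_iUnion]
      refine ⟨a, ha, ?_⟩
      rw [Finset.mem_coe, Finset.mem_union, Finset.mem_powerset, Finset.mem_powerset]
      have hadm := (hMmem a).1 ha
      refine h.imp (fun h p hp => ?_) (fun h p hp => ?_)
      · exact (mem_primesDividing_span (ne_zero_of_mem_admissible hadm)).2 (mem_primeProd.1 h p hp)
      · exact (mem_primesDividing_span hadm.2.2).2 (mem_primeProd.1 h p hp)
    exact (M.finite_toSet.biUnion fun a _ => Finset.finite_toSet _).subset this
  set F := hFfin.toFinset with hF
  have hFmem : ∀ S, S ∈ F ↔ ∃ a ∈ M, a ∈ primeProd S ∨ a + k ∈ primeProd S := fun S =>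
    hFfin.mem_toFinset
  set n : Finset (HeightOneSpectrum (𝓞 K)) × Finset (HeightOneSpectrum (𝓞 K)) → ℝ := fun P =>
    ({a ∈ admissible σ m k α β r | a ∈ primeProd P.1 ∧ a + k ∈ primeProd P.2}.ncard : ℝ) with hn
  have hnM : ∀ P, n P = ∑ a ∈ M, if a ∈ primeProd P.1 ∧ a + k ∈ primeProd P.2 then (1 : ℝ) else 0 := by
    intro P
    rw [Finset.sum_boole, ← Set.ncard_coe_finset]
    simp only [hn]
    congr 2
    ext a
    simp only [Finset.coe_filter, hMmem, Set.mem_ofPred_eq]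
  have hratio : ratioSum σ m k α β r
      = ∑ P ∈ F ×ˢ F, moebiusWeight P.1 * moebiusWeight P.2 * n P := by
    rw [ratioSum, finsum_mem_eq_finite_toFinset_sum _ hfin]
    simp only [hnM, Finset.mul_sum]
    rw [Finset.sum_comm]
    refine Finset.sum_congr rfl fun a ha => ?_
    have hadm := (hMmem a).1 ha
    rw [phiRatio_eq_sum (ne_zero_of_mem_admissible hadm) (F := F)
        (fun S hS => (hFmem S).2 ⟨a, ha, Or.inl hS⟩),
      phiRatio_eq_sum hadm.2.2 (F := F) (fun S hS => (hFmem S).2 ⟨a, ha, Or.inr hS⟩),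
      Finset.sum_mul_sum, ← Finset.sum_product']
    refine Finset.sum_congr rfl fun P _ => ?_
    by_cases hA : a ∈ primeProd P.1 <;> by_cases hB : a + k ∈ primeProd P.2 <;> simp [hA, hB]
  have hzero : ∀ P ∉ F ×ˢ F, moebiusWeight P.1 * moebiusWeight P.2 * n P = 0 := by
    intro P hP
    rw [hnM, Finset.sum_eq_zero, mul_zero]
    intro a ha
    rw [if_neg]
    rintro ⟨hA, hB⟩
    exact hP (Finset.mem_product.2 ⟨(hFmem _).2 ⟨a, ha, Or.inl hA⟩, (hFmem _).2 ⟨a, ha, Or.inr hB⟩⟩)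
  have hs1 : HasSum (fun P : Finset (HeightOneSpectrum (𝓞 K)) × Finset (HeightOneSpectrum (𝓞 K)) =>
      moebiusWeight P.1 * moebiusWeight P.2 * n P) (ratioSum σ m k α β r) := by
    rw [hratio]
    exact hasSum_sum_of_ne_finset_zero hzero
  have hs2 := ((summable_densityConst σ hK hm k).hasSum).mul_left
    ((β - α) * r ^ 2 / Real.sqrt |(discr K : ℝ)|)
  have hs3 := hs1.sub hs2
  obtain ⟨hs4, hb⟩ := summable_absNorm_prod σ hK
  rw [densityConst, ← Real.norm_eq_abs, ← hs3.tsum_eq]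
  refine (tsum_of_norm_bounded (hs4.hasSum.mul_left (62 * r)) fun P => ?_).trans ?_
  · rw [Real.norm_eq_abs]
    exact count_divisible_summable σ hK hm k h1 h2 hr hk P.1 P.2
  · calc 62 * r * _ ≤ 62 * r * zetaBound ^ 2 := by gcongr
      _ = _ := by ring

end Density

/-! ### The constant -/

section Constant

open NumberField IsDedekindDomain

variable {K : Type*} [Field K] [NumberField K]

lemma ratioSum_nonneg (σ : K →+* ℂ) (m : Ideal (𝓞 K)) (k : 𝓞 K) (α β r : ℝ) :
    0 ≤ ratioSum σ m k α β r :=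
  finsum_nonneg fun _ => finsum_nonneg fun _ => mul_nonneg (phiRatio_nonneg _) (phiRatio_nonneg _)

variable [IsTotallyComplex K] [IsPrincipalIdealRing (𝓞 K)]

/-- On average, `∑ 1 / N(p)` over the prime divisors of an element is bounded. -/
lemma sum_primesDividing_le (σ : K →+* ℂ) (hK : Module.finrank ℚ K = 2) {R : ℝ} (hR : 0 ≤ R)
    (M : Finset (𝓞 K)) (hM : ∀ a ∈ M, a ≠ 0 ∧ ‖σ a‖ ≤ R) :
    ∑ a ∈ M, ∑ p ∈ primesDividing (Ideal.span {a}), 1 / (Ideal.absNorm p.asIdeal : ℝ)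
      ≤ 60 * R ^ 2 * zetaBound := by
  classical
  set F := M.biUnion fun a => primesDividing (Ideal.span {a}) with hF
  obtain ⟨hs, hb⟩ := tsum_absNorm_rpow_le σ hK (HeightOneSpectrum.asIdeal (R := 𝓞 K))
    (fun p q h => HeightOneSpectrum.ext h) (fun p => p.ne_bot)
  have hswap : ∑ a ∈ M, ∑ p ∈ primesDividing (Ideal.span {a}), 1 / (Ideal.absNorm p.asIdeal : ℝ)
      = ∑ p ∈ F, ∑ a ∈ M with a ∈ p.asIdeal, 1 / (Ideal.absNorm p.asIdeal : ℝ) := by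
    refine Finset.sum_comm' fun a p => ?_
    rw [hF, Finset.mem_biUnion, Finset.mem_filter]
    constructor
    · rintro ⟨ha, hp⟩
      exact ⟨⟨ha, (mem_primesDividing_span (hM a ha).1).1 hp⟩, a, ha, hp⟩
    · rintro ⟨⟨ha, hp⟩, -⟩
      exact ⟨ha, (mem_primesDividing_span (hM a ha).1).2 hp⟩
  rw [hswap]
  have hterm : ∀ p ∈ F, ∑ a ∈ M with a ∈ p.asIdeal, 1 / (Ideal.absNorm p.asIdeal : ℝ)
      ≤ 60 * R ^ 2 * (Ideal.absNorm p.asIdeal : ℝ) ^ (-(5 / 4) : ℝ) := by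
    intro p _
    obtain ⟨hf, hc⟩ := count_disc_le σ hK p.ne_bot hR
    have hN : (1 : ℝ) ≤ Ideal.absNorm p.asIdeal := one_le_absNorm p.ne_bot
    set N : ℝ := (Ideal.absNorm p.asIdeal : ℝ)
    rw [Finset.sum_const, nsmul_eq_mul]
    have h1 : ((M.filter (· ∈ p.asIdeal)).card : ℝ) ≤ 60 * R ^ 2 / N := by
      refine le_trans ?_ hc
      rw [← Set.ncard_coe_finset]
      have : ((M.filter (· ∈ p.asIdeal) : Finset (𝓞 K)) : Set (𝓞 K))
          ⊆ {a : 𝓞 K | a ∈ p.asIdeal ∧ a ≠ 0 ∧ ‖σ a‖ ≤ R} := by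
        intro a ha
        rw [Finset.coe_filter] at ha
        exact ⟨ha.2, hM a ha.1⟩
      exact_mod_cast Set.ncard_le_ncard this hf
    calc _ ≤ 60 * R ^ 2 / N * (1 / N) := by gcongr
      _ = 60 * R ^ 2 * N ^ (-2 : ℝ) := by
        rw [Real.rpow_neg (by linarith), Real.rpow_two]; field_simp
      _ ≤ _ := by
        gcongr
        norm_num
  refine (Finset.sum_le_sum hterm).trans ?_
  rw [← Finset.mul_sum]
  gcongr
  exact (hs.sum_le_tsum F fun _ _ => by positivity).trans hb

/-- The density is at most `1`, since `φ(a) ≤ N(a)` and `m` has density at most `1`. -/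
lemma densityConst_le_one (σ : K →+* ℂ) (hK : Module.finrank ℚ K = 2) {m : Ideal (𝓞 K)}
    (hm : m ≠ ⊥) (k : 𝓞 K) : densityConst m k ≤ 1 := by
  have hpi := Real.pi_pos
  have hs := sqrt_abs_discr_ge hK
  set D := Real.sqrt |(discr K : ℝ)| with hD
  set κ := 2 * Real.pi / D with hκ
  have hκ0 : 0 < κ := div_pos (by linarith) (by linarith)
  set c := densityConst m k with hc
  by_contra! hc1
  set B := 62 * zetaBound ^ 2 + 20 with hB
  have hB0 : 0 < B := by positivity
  have hden : 0 < (c - 1) * κ := mul_pos (by linarith) hκ0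
  -- for this radius the quadratic main term exceeds the linear error terms
  set r := (B + 20) / ((c - 1) * κ) + ‖σ k‖ + 1 with hr
  have hk0 := norm_nonneg (σ k)
  have hq : 0 < (B + 20) / ((c - 1) * κ) := by positivity
  have hr1 : 1 ≤ r := by linarith
  have hasym := ratioSum_asymptotic σ hK hm k (α := -Real.pi) (β := Real.pi) (by linarith)
    (by linarith) (by linarith : 0 < r) (by linarith)
  obtain ⟨hfin, -⟩ := admissible_finite σ hK hm k (-Real.pi) Real.pi (by linarith : 0 ≤ r)
  obtain ⟨hf, hcount⟩ := count_coset σ hK (L := ⊤) top_ne_bot 0 (α := -Real.pi) (β := Real.pi)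
    (by linarith) (by linarith) (by linarith : 0 ≤ r)
  have hle : ratioSum σ m k (-Real.pi) Real.pi r
      ≤ {a : 𝓞 K | a - 0 ∈ (⊤ : Ideal (𝓞 K)) ∧ σ a ∈ angularSector (-Real.pi) Real.pi r}.ncard := by
    rw [ratioSum, finsum_mem_eq_finite_toFinset_sum _ hfin]
    refine (Finset.sum_le_sum (g := fun _ => (1 : ℝ)) fun a ha => ?_).trans ?_
    · have ha' := (hfin.mem_toFinset).1 ha
      exact mul_le_one₀ (phiRatio_le_one (ne_zero_of_mem_admissible ha')) (phiRatio_nonneg _)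
        (phiRatio_le_one ha'.2.2)
    · rw [Finset.sum_const, nsmul_eq_mul, mul_one, ← Set.ncard_eq_toFinset_card _ hfin]
      have hsub : admissible σ m k (-Real.pi) Real.pi r ⊆
          {a : 𝓞 K | a - 0 ∈ (⊤ : Ideal (𝓞 K)) ∧ σ a ∈ angularSector (-Real.pi) Real.pi r} :=
        fun a ha => ⟨Submodule.mem_top, ha.2.1⟩
      exact_mod_cast Set.ncard_le_ncard hsub hf
  rw [Ideal.absNorm_top, Nat.cast_one, Real.sqrt_one, mul_one, div_one] at hcount
  have e1 : (Real.pi - -Real.pi) * r ^ 2 / D = κ * r ^ 2 := by rw [hκ]; ring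
  rw [e1] at hasym hcount
  have h1 := (abs_le.1 hasym).1
  have h2 := (abs_le.1 hcount).2
  have h3 : (c - 1) * κ * r ^ 2 ≤ B * r + 20 := by
    rw [hB]; nlinarith
  have h4 : B + 20 < (c - 1) * κ * r := by
    rw [hr]
    have : (c - 1) * κ * ((B + 20) / ((c - 1) * κ)) = B + 20 := by field_simp
    nlinarith
  nlinarith

/-- The density is positive: the sum over `r`-bounded points is at least a positive multiple of
`r ^ 2`, because `∑ 1 / N(p)` over the primes dividing `a` or `a + k` is bounded on average. -/
lemma densityConst_pos (σ : K →+* ℂ) (hK : Module.finrank ℚ K = 2) {m : Ideal (𝓞 K)}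
    (hm : m ≠ ⊥) (k : 𝓞 K) : 0 < densityConst m k := by
  classical
  have hpi := Real.pi_pos
  have hs := sqrt_abs_discr_ge hK
  have hN := one_le_absNorm hm
  set N : ℝ := (Ideal.absNorm m : ℝ) with hNdef
  set D := Real.sqrt |(discr K : ℝ)| with hD
  set κ := 2 * Real.pi / D with hκ
  have hκ0 : 0 < κ := div_pos (by linarith) (by linarith)
  set c := densityConst m k with hc
  set B := 62 * zetaBound ^ 2 with hB
  have hB0 : 0 ≤ B := by positivity
  set η := κ / (2 * N) with hη
  have hη0 : 0 < η := by positivity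
  -- `T` is an upper bound for the average over the points of the exponents in `exp_le_phiRatio`
  set T := 600 * zetaBound / η with hT
  have hZ := zetaBound_nonneg
  have hT0 : 0 ≤ T := by positivity
  by_contra! hc0
  -- large enough to absorb the linear errors in the number of points and in `ratioSum_asymptotic`
  set r := 41 / η + (B + 1) / (Real.exp (-T) * η) + ‖σ k‖ + 1 with hr
  have hk0 := norm_nonneg (σ k)
  have hexp := Real.exp_pos (-T)
  have q1 : 0 < 41 / η := by positivity
  have q2 : 0 < (B + 1) / (Real.exp (-T) * η) := by positivity
  have hr1 : 1 ≤ r := by linarith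
  have hkr : ‖σ k‖ ≤ r := by linarith
  have hasym := ratioSum_asymptotic σ hK hm k (α := -Real.pi) (β := Real.pi) (by linarith)
    (by linarith) (by linarith : 0 < r) hkr
  obtain ⟨hfin, -⟩ := admissible_finite σ hK hm k (-Real.pi) Real.pi (by linarith : 0 ≤ r)
  set M := hfin.toFinset with hM
  have hMmem : ∀ a, a ∈ M ↔ a ∈ admissible σ m k (-Real.pi) Real.pi r := fun a => hfin.mem_toFinset
  obtain ⟨hf, hcount⟩ := count_coset σ hK hm 0 (α := -Real.pi) (β := Real.pi)
    (by linarith) (by linarith) (by linarith : 0 ≤ r)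
  -- a lower bound for the number of admissible points
  have hcard : η * r ^ 2 ≤ M.card := by
    set Q := {a : 𝓞 K | a - 0 ∈ m ∧ σ a ∈ angularSector (-Real.pi) Real.pi r} with hQ
    have hsub : Q \ {-k} ⊆ M := by
      rintro a ⟨ha, hak⟩
      rw [Finset.mem_coe, hMmem]
      exact ⟨by simpa using ha.1, ha.2, fun h => hak (eq_neg_of_add_eq_zero_left h)⟩
    have h3 := Set.ncard_le_ncard hsub M.finite_toSet
    rw [Set.ncard_coe_finset] at h3
    have h4 := Set.ncard_le_ncard_sdiff_add_ncard Q {-k} (Set.finite_singleton _)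
    rw [Set.ncard_singleton] at h4
    have h5 : (Q.ncard : ℝ) ≤ M.card + 1 := by exact_mod_cast h4.trans (by omega)
    have h6 := (abs_le.1 hcount).1
    have h7 : r / Real.sqrt N ≤ r := div_le_self (by linarith) (by
      rw [Real.le_sqrt' one_pos]; simpa using hN)
    have h8 : (Real.pi - -Real.pi) * r ^ 2 / (D * N) = 2 * (η * r ^ 2) := by
      rw [hη, hκ]
      field_simp
      ring
    rw [h8] at h6
    have h9 : 41 ≤ η * r := by
      rw [← div_le_iff₀' hη0]
      linarith
    have h10 : 41 * r ≤ η * r * r := mul_le_mul_of_nonneg_right h9 (by linarith)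
    linarith
  set X : 𝓞 K → ℝ := fun a =>
    ∑ p ∈ primesDividing (Ideal.span {a}), 1 / (Ideal.absNorm p.asIdeal : ℝ) with hX
  have hX1 : ∑ a ∈ M, X a ≤ 60 * r ^ 2 * zetaBound :=
    sum_primesDividing_le σ hK (by linarith) M fun a ha =>
      ⟨ne_zero_of_mem_admissible ((hMmem a).1 ha), norm_le_of_mem_angularSector ((hMmem a).1 ha).2.1⟩
  have hX2 : ∑ a ∈ M, X (a + k) ≤ 60 * (2 * r) ^ 2 * zetaBound := by
    have := sum_primesDividing_le σ hK (R := 2 * r) (by linarith) (M.map (addRightEmbedding k)) (by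
      intro b hb
      obtain ⟨a, ha, rfl⟩ := Finset.mem_map.1 hb
      exact ⟨((hMmem a).1 ha).2.2, norm_add_le_of_mem_admissible ((hMmem a).1 ha) hkr⟩)
    rw [Finset.sum_map] at this
    exact this
  -- the exponential lies above its tangent at `-T`
  have hpoint : ∀ a ∈ M, Real.exp (-T) * (1 + T - 2 * X a - 2 * X (a + k))
      ≤ phiRatio a * phiRatio (a + k) := by
    intro a ha
    have ha' := (hMmem a).1 ha
    have g1 := exp_le_phiRatio (ne_zero_of_mem_admissible ha')
    have g2 := exp_le_phiRatio ha'.2.2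
    calc Real.exp (-T) * (1 + T - 2 * X a - 2 * X (a + k))
        ≤ Real.exp (-T) * Real.exp (T - 2 * X a - 2 * X (a + k)) := by
          gcongr
          linarith [Real.add_one_le_exp (T - 2 * X a - 2 * X (a + k))]
      _ = Real.exp (-2 * X a) * Real.exp (-2 * X (a + k)) := by
          rw [← Real.exp_add, ← Real.exp_add]; ring_nf
      _ ≤ _ := mul_le_mul g1 g2 (Real.exp_pos _).le (phiRatio_nonneg _)
  have hlow : Real.exp (-T) * (η * r ^ 2) ≤ ratioSum σ m k (-Real.pi) Real.pi r := by
    rw [ratioSum, finsum_mem_eq_finite_toFinset_sum _ hfin]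
    refine le_trans ?_ (Finset.sum_le_sum hpoint)
    rw [← Finset.mul_sum]
    gcongr
    rw [Finset.sum_sub_distrib, Finset.sum_sub_distrib, Finset.sum_const, ← Finset.mul_sum,
      ← Finset.mul_sum, nsmul_eq_mul]
    have hTη : T * η = 600 * zetaBound := by rw [hT]; field_simp
    have : T * (η * r ^ 2) ≤ T * M.card := by gcongr
    have e : T * (η * r ^ 2) = 600 * zetaBound * r ^ 2 := by rw [← hTη]; ring
    linarith
  have h1 := (abs_le.1 hasym).2
  have h2 : (Real.pi - -Real.pi) * r ^ 2 / D * c ≤ 0 :=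
    mul_nonpos_of_nonneg_of_nonpos (by
      apply div_nonneg _ (by linarith)
      nlinarith [sq_nonneg r]) hc0
  have h3 : Real.exp (-T) * η * r ^ 2 ≤ B * r := by linarith
  have h4 : B + 1 ≤ Real.exp (-T) * η * r := by
    rw [← div_le_iff₀' (by positivity)]
    linarith
  have h5 : (B + 1) * r ≤ Real.exp (-T) * η * r * r := mul_le_mul_of_nonneg_right h4 (by linarith)
  linarith

/-- A version of `ratioSum_asymptotic` without a lower bound for the radius. -/
lemma ratioSum_asymptotic_all (σ : K →+* ℂ) (hK : Module.finrank ℚ K = 2) {m : Ideal (𝓞 K)}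
    (hm : m ≠ ⊥) (k : 𝓞 K) {α β : ℝ} (h1 : α < β) (h2 : β - α ≤ 2 * Real.pi) {r : ℝ} (hr : 0 < r) :
    |ratioSum σ m k α β r - (β - α) / Real.sqrt |(discr K : ℝ)| * densityConst m k * r ^ 2|
      ≤ (62 * zetaBound ^ 2 + 64) * (1 + ‖σ k‖) * r := by
  have hk0 := norm_nonneg (σ k)
  rcases le_or_gt ‖σ k‖ r with hk | hk
  · have h := ratioSum_asymptotic σ hK hm k h1 h2 hr hk
    have e : (β - α) / Real.sqrt |(discr K : ℝ)| * densityConst m k * r ^ 2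
        = (β - α) * r ^ 2 / Real.sqrt |(discr K : ℝ)| * densityConst m k := by ring
    rw [e]
    have p1 : 0 ≤ 62 * zetaBound ^ 2 * ‖σ k‖ * r := by positivity
    have p2 : 0 ≤ 64 * (1 + ‖σ k‖) * r := by positivity
    linarith
  · have hc1 := densityConst_le_one σ hK hm k
    have hc0 := densityConst_pos σ hK hm k
    have hcoef := main_coeff_le hK h2
    have hs := sqrt_abs_discr_ge hK
    have hκ0 : 0 ≤ (β - α) / Real.sqrt |(discr K : ℝ)| := div_nonneg (by linarith) (by linarith)
    obtain ⟨hfin, hcard⟩ := admissible_finite σ hK hm k α β hr.le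
    have hA : ratioSum σ m k α β r ≤ 60 * r ^ 2 := by
      refine le_trans ?_ hcard
      rw [ratioSum, finsum_mem_eq_finite_toFinset_sum _ hfin]
      refine (Finset.sum_le_sum (g := fun _ => (1 : ℝ)) fun a ha => ?_).trans ?_
      · have ha' := (hfin.mem_toFinset).1 ha
        exact mul_le_one₀ (phiRatio_le_one (ne_zero_of_mem_admissible ha')) (phiRatio_nonneg _)
          (phiRatio_le_one ha'.2.2)
      · rw [Finset.sum_const, nsmul_eq_mul, mul_one, ← Set.ncard_eq_toFinset_card _ hfin]
    have hA0 := ratioSum_nonneg σ m k α β r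
    have hmain : (β - α) / Real.sqrt |(discr K : ℝ)| * densityConst m k ≤ 4 * 1 := by gcongr
    have hmain0 : 0 ≤ (β - α) / Real.sqrt |(discr K : ℝ)| * densityConst m k := by positivity
    set E := (β - α) / Real.sqrt |(discr K : ℝ)| * densityConst m k
    have h3 : |ratioSum σ m k α β r - E * r ^ 2| ≤ 64 * r ^ 2 := by
      rw [abs_le]
      constructor <;> nlinarith [sq_nonneg r]
    have h4 : r ^ 2 ≤ (1 + ‖σ k‖) * r := by nlinarith
    have h5 : 0 ≤ 62 * zetaBound ^ 2 * ((1 + ‖σ k‖) * r) := by positivity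
    calc _ ≤ 64 * r ^ 2 := h3
      _ ≤ 64 * ((1 + ‖σ k‖) * r) := by gcongr
      _ ≤ _ := by linarith

end Constant

/-! ### Summation by parts and the weighted sum -/

section Summation

/-- Summation by parts: an asymptotic formula for a counting function gives one for the sum of
the fourth powers. -/
lemma sum_fourth_pow_asymptotic {ι : Type*} (M : Finset ι) (w ρ : ι → ℝ) {x κ B : ℝ} (hx : 0 < x)
    (hρ : ∀ a ∈ M, 0 < ρ a ∧ ρ a ≤ x)
    (h : ∀ r ∈ Set.Ioc 0 x, |(∑ a ∈ M, if ρ a ≤ r then w a else 0) - κ * r ^ 2| ≤ B * r) :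
    |∑ a ∈ M, w a * ρ a ^ 4 - κ / 3 * x ^ 6| ≤ 5 * B * x ^ 5 := by
  set A : ℝ → ℝ := fun r => ∑ a ∈ M, if ρ a ≤ r then w a else 0 with hA
  have hB : 0 ≤ B := by
    have := (abs_nonneg _).trans (h x ⟨hx, le_rfl⟩)
    exact nonneg_of_mul_nonneg_left this hx
  have hAx : A x = ∑ a ∈ M, w a := Finset.sum_congr rfl fun a ha => if_pos (hρ a ha).2
  have hpoly : ∀ b : ℝ, ∫ r in b..x, 4 * r ^ 3 = x ^ 4 - b ^ 4 := by
    intro b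
    rw [intervalIntegral.integral_const_mul, integral_pow]
    norm_num
    ring
  have hind : ∀ a ∈ M, IntervalIntegrable (fun r => 4 * r ^ 3 * (if ρ a ≤ r then w a else 0))
      volume 0 x ∧ ∫ r in (0 : ℝ)..x, 4 * r ^ 3 * (if ρ a ≤ r then w a else 0)
        = w a * (x ^ 4 - ρ a ^ 4) := by
    intro a ha
    obtain ⟨h0, h1⟩ := hρ a ha
    have e : (fun r => 4 * r ^ 3 * (if ρ a ≤ r then w a else 0))
        = Set.indicator (Set.Ici (ρ a)) (fun r => w a * (4 * r ^ 3)) := by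
      ext r
      by_cases hr : ρ a ≤ r
      · rw [Set.indicator_of_mem (Set.mem_Ici.2 hr), if_pos hr]; ring
      · rw [Set.indicator_of_notMem (fun h => hr (Set.mem_Ici.1 h)), if_neg hr]; ring
    rw [e]
    have hcont : Continuous fun r : ℝ => w a * (4 * r ^ 3) := by fun_prop
    constructor
    · rw [intervalIntegrable_iff]
      exact (intervalIntegrable_iff.1 (hcont.intervalIntegrable 0 x)).indicator measurableSet_Ici
    · rw [intervalIntegral.integral_of_le hx.le, setIntegral_indicator measurableSet_Ici]
      have : Set.Ioc 0 x ∩ Set.Ici (ρ a) = Set.Icc (ρ a) x := by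
        ext r
        simp only [Set.mem_inter_iff, Set.mem_Ioc, Set.mem_Ici, Set.mem_Icc]
        exact ⟨fun h => ⟨h.2, h.1.2⟩, fun h => ⟨⟨h0.trans_le h.1, h.2⟩, h.1⟩⟩
      rw [this, integral_Icc_eq_integral_Ioc, ← intervalIntegral.integral_of_le h1,
        intervalIntegral.integral_const_mul, hpoly]
  have hAeq : (fun r => 4 * r ^ 3 * A r)
      = fun r => ∑ a ∈ M, 4 * r ^ 3 * (if ρ a ≤ r then w a else 0) := by
    ext r; rw [hA, Finset.mul_sum]
  have hAint : IntervalIntegrable (fun r => 4 * r ^ 3 * A r) volume 0 x := by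
    rw [hAeq]
    have hsum := IntervalIntegrable.sum M fun a ha => (hind a ha).1
    rwa [Finset.sum_fn] at hsum
  have hAval : ∫ r in (0 : ℝ)..x, 4 * r ^ 3 * A r = ∑ a ∈ M, w a * (x ^ 4 - ρ a ^ 4) := by
    rw [hAeq, intervalIntegral.integral_finsetSum fun a ha => (hind a ha).1]
    exact Finset.sum_congr rfl fun a ha => (hind a ha).2
  have hmainint : IntervalIntegrable (fun r : ℝ => 4 * κ * r ^ 5) volume 0 x :=
    Continuous.intervalIntegrable (by fun_prop) _ _
  have hmainval : ∫ r in (0 : ℝ)..x, 4 * κ * r ^ 5 = 2 / 3 * κ * x ^ 6 := by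
    rw [intervalIntegral.integral_const_mul, integral_pow]
    norm_num
    ring
  have hdiff : ∑ a ∈ M, w a * ρ a ^ 4 - κ / 3 * x ^ 6
      = x ^ 4 * (A x - κ * x ^ 2) - ∫ r in (0 : ℝ)..x, (4 * r ^ 3 * A r - 4 * κ * r ^ 5) := by
    rw [intervalIntegral.integral_sub hAint hmainint, hAval, hmainval, hAx]
    simp only [mul_sub, Finset.sum_sub_distrib, ← Finset.sum_mul]
    ring
  have hint : |∫ r in (0 : ℝ)..x, (4 * r ^ 3 * A r - 4 * κ * r ^ 5)| ≤ 4 * B * x ^ 4 * x := by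
    have := intervalIntegral.norm_integral_le_of_norm_le_const (a := 0) (b := x)
      (f := fun r => 4 * r ^ 3 * A r - 4 * κ * r ^ 5) (C := 4 * B * x ^ 4) (by
        intro r hr
        rw [Set.uIoc_of_le hx.le] at hr
        have e : 4 * r ^ 3 * A r - 4 * κ * r ^ 5 = 4 * r ^ 3 * (A r - κ * r ^ 2) := by ring
        have hr0 := hr.1.le
        rw [e, Real.norm_eq_abs, abs_mul, abs_of_nonneg (by positivity)]
        calc 4 * r ^ 3 * |A r - κ * r ^ 2| ≤ 4 * r ^ 3 * (B * r) := by gcongr; exact h r hr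
          _ = 4 * B * r ^ 4 := by ring
          _ ≤ 4 * B * x ^ 4 := by gcongr; exact hr.2)
    rwa [Real.norm_eq_abs, sub_zero, abs_of_pos hx] at this
  have hlead : |x ^ 4 * (A x - κ * x ^ 2)| ≤ x ^ 4 * (B * x) := by
    rw [abs_mul, abs_of_nonneg (by positivity)]
    gcongr
    exact h x ⟨hx, le_rfl⟩
  rw [hdiff]
  refine (abs_sub _ _).trans ((add_le_add hlead hint).trans (le_of_eq (by ring)))

open NumberField in
/-- The estimate of the theorem, with explicit constants. -/
lemma shiftedEulerSum_estimate {K : Type*} [Field K] [NumberField K] [IsTotallyComplex K]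
    [IsPrincipalIdealRing (𝓞 K)] (σ : K →+* ℂ) (hK : Module.finrank ℚ K = 2) (k : 𝓞 K)
    {m : Ideal (𝓞 K)} (hm : m ≠ ⊥) {z : ℂ} {θ x : ℝ} (hz : z ≠ 0)
    (hθ : θ ∈ Set.Ioc 0 (2 * Real.pi)) (hx : 0 < x) :
    |shiftedEulerSum σ m k z θ x
        - θ * densityConst m k / (3 * Real.sqrt |(discr K : ℝ)|) * x ^ 6|
      ≤ (5 * (62 * zetaBound ^ 2 + 64) + 120) *
        ((1 + Real.sqrt (intNorm k : ℝ)) * x ^ 5 + (intNorm k : ℝ) * x ^ 4) := by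
  classical
  set α := z.arg - θ / 2 with hα
  set β := z.arg + θ / 2 with hβ
  have hβα : β - α = θ := by rw [hα, hβ]; ring
  have h1 : α < β := by linarith [hθ.1]
  have h2 : β - α ≤ 2 * Real.pi := by rw [hβα]; exact hθ.2
  have hset : ∀ r, {a | a ∈ sectorPoints σ m z θ r ∧ a + k ≠ 0} = admissible σ m k α β r := by
    intro r
    ext a
    simp only [sectorPoints, admissible, truncatedSector_eq_angularSector hz, Set.mem_ofPred_eq,
      and_assoc]
    rfl
  obtain ⟨hfin, hcard⟩ := admissible_finite σ hK hm k α β hx.le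
  set M := hfin.toFinset with hM
  have hMmem : ∀ a, a ∈ M ↔ a ∈ admissible σ m k α β x := fun a => hfin.mem_toFinset
  have hMcard : (M.card : ℝ) ≤ 60 * x ^ 2 := by
    rwa [Set.ncard_eq_toFinset_card _ hfin] at hcard
  have hk2 : (intNorm k : ℝ) = ‖σ k‖ ^ 2 := intNorm_eq_normSq σ hK k
  set t := ‖σ k‖ with ht
  have ht0 : 0 ≤ t := norm_nonneg _
  set w : 𝓞 K → ℝ := fun a => phiRatio a * phiRatio (a + k) with hw
  set ρ : 𝓞 K → ℝ := fun a => ‖σ a‖ with hρ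
  have hρM : ∀ a ∈ M, 0 < ρ a ∧ ρ a ≤ x := by
    intro a ha
    have ha' := (hMmem a).1 ha
    exact ⟨norm_pos_iff.2 (ne_zero_of_mem_angularSector ha'.2.1),
      norm_le_of_mem_angularSector ha'.2.1⟩
  have hwM : ∀ a ∈ M, 0 ≤ w a ∧ w a ≤ 1 := by
    intro a ha
    have ha' := (hMmem a).1 ha
    exact ⟨mul_nonneg (phiRatio_nonneg _) (phiRatio_nonneg _),
      mul_le_one₀ (phiRatio_le_one (ne_zero_of_mem_admissible ha')) (phiRatio_nonneg _)
        (phiRatio_le_one ha'.2.2)⟩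
  -- the sum with both norms replaced by `N(a)`
  have hfirst := sum_fourth_pow_asymptotic M w ρ (κ := θ / Real.sqrt |(discr K : ℝ)| * densityConst m k)
    (B := (62 * zetaBound ^ 2 + 64) * (1 + t)) hx hρM (by
      intro r hr
      have h3 := ratioSum_asymptotic_all σ hK hm k h1 h2 hr.1
      obtain ⟨hfinr, -⟩ := admissible_finite σ hK hm k α β hr.1.le
      rw [hβα] at h3
      convert h3 using 3
      rw [ratioSum, finsum_mem_eq_finite_toFinset_sum _ hfinr, ← Finset.sum_filter]
      refine Finset.sum_congr ?_ fun a _ => rfl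
      ext a
      rw [Finset.mem_filter, hMmem, hfinr.mem_toFinset]
      have hsec := mem_angularSector_of_le (α := α) (β := β) (R := x) (r := r) (w := σ a)
      constructor
      · rintro ⟨⟨ha1, ha2, ha3⟩, har⟩
        exact ⟨ha1, (hsec.1 ⟨ha2, har, hr.2⟩).1, ha3⟩
      · rintro ⟨ha1, ha2, ha3⟩
        have := hsec.2 ⟨ha2, hr.2⟩
        exact ⟨⟨ha1, this.1, ha3⟩, this.2.1⟩)
  have hsum : shiftedEulerSum σ m k z θ x = ∑ a ∈ M, w a * (ρ a ^ 2 * ‖σ (a + k : 𝓞 K)‖ ^ 2) := by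
    rw [shiftedEulerSum, hset, finsum_mem_eq_finite_toFinset_sum _ hfin]
    refine Finset.sum_congr rfl fun a ha => ?_
    have ha' := (hMmem a).1 ha
    rw [eulerPhi_eq_mul_phiRatio (ne_zero_of_mem_admissible ha'), eulerPhi_eq_mul_phiRatio ha'.2.2,
      intNorm_eq_normSq σ hK, intNorm_eq_normSq σ hK]
    simp only [hw, hρ]
    ring
  have hsecond : |∑ a ∈ M, w a * (ρ a ^ 2 * ‖σ (a + k : 𝓞 K)‖ ^ 2) - ∑ a ∈ M, w a * ρ a ^ 4|
      ≤ 60 * x ^ 2 * (x ^ 2 * (t * (2 * x + t))) := by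
    rw [← Finset.sum_sub_distrib]
    refine (Finset.abs_sum_le_sum_abs _ _).trans ?_
    refine (Finset.sum_le_sum (g := fun _ => x ^ 2 * (t * (2 * x + t))) fun a ha => ?_).trans ?_
    · obtain ⟨hw0, hw1⟩ := hwM a ha
      obtain ⟨hρ0, hρx⟩ := hρM a ha
      have e : w a * (ρ a ^ 2 * ‖σ (a + k : 𝓞 K)‖ ^ 2) - w a * ρ a ^ 4
          = w a * (ρ a ^ 2 * ((‖σ (a + k : 𝓞 K)‖ - ρ a) * (‖σ (a + k : 𝓞 K)‖ + ρ a))) := by ring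
      have hσ : σ (a + k : 𝓞 K) = σ a + σ k := by push_cast; rw [map_add]
      have d1 : |‖σ (a + k : 𝓞 K)‖ - ρ a| ≤ t := by
        have := abs_norm_sub_norm_le (σ (a + k : 𝓞 K)) (σ a)
        rwa [hσ, add_sub_cancel_left, ← hσ] at this
      have d2 : ‖σ (a + k : 𝓞 K)‖ + ρ a ≤ 2 * x + t := by
        have := (abs_le.1 d1).2
        linarith
      rw [e, abs_mul (w a), abs_mul (ρ a ^ 2), abs_mul (_ - ρ a), abs_of_nonneg hw0, abs_of_nonneg (sq_nonneg (ρ a)),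
        abs_of_nonneg (show 0 ≤ ‖σ (a + k : 𝓞 K)‖ + ρ a by positivity)]
      calc _ ≤ 1 * (x ^ 2 * (t * (2 * x + t))) := by gcongr
        _ = _ := one_mul _
    · rw [Finset.sum_const, nsmul_eq_mul]
      gcongr
  rw [hsum, hk2, Real.sqrt_sq ht0]
  have e : θ * densityConst m k / (3 * Real.sqrt |(discr K : ℝ)|)
      = θ / Real.sqrt |(discr K : ℝ)| * densityConst m k / 3 := by
    have := sqrt_abs_discr_ge hK
    field_simp
  rw [e]
  refine (abs_sub_le _ (∑ a ∈ M, w a * ρ a ^ 4) _).trans ((add_le_add hsecond hfirst).trans ?_)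
  have hZ : 0 ≤ zetaBound ^ 2 := sq_nonneg _
  have n1 : 0 ≤ x ^ 5 := by positivity
  have n2 : 0 ≤ t * x ^ 5 := by positivity
  have n3 : 0 ≤ t ^ 2 * x ^ 4 := by positivity
  have n4 := mul_nonneg hZ n3
  nlinarith

end Summation

theorem theorem4p1 :
    ∃ C : ℝ, 0 < C ∧
      ∀ (K : Type*) [Field K] [NumberField K] [NumberField.IsTotallyComplex K]
        [IsPrincipalIdealRing (NumberField.RingOfIntegers K)] (σ : K →+* ℂ),
        Module.finrank ℚ K = 2 →
        ∀ (k : NumberField.RingOfIntegers K) (m : Ideal (NumberField.RingOfIntegers K)), m ≠ ⊥ →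
          ∃ c : ℝ, c ∈ Set.Ioc (0 : ℝ) 1 ∧
            ∀ (z : ℂ) (θ x : ℝ), z ≠ 0 → θ ∈ Set.Ioc 0 (2 * Real.pi) → 1 ≤ x →
              (sectorPoints σ m z θ x).Finite ∧
              |shiftedEulerSum σ m k z θ x
                  - θ * c / (3 * Real.sqrt |(NumberField.discr K : ℝ)|) * x ^ 6|
                ≤ C * ((1 + Real.sqrt (intNorm k : ℝ)) * x ^ 5 + (intNorm k : ℝ) * x ^ 4) := by
  refine ⟨5 * (62 * zetaBound ^ 2 + 64) + 120, by positivity, ?_⟩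
  intro K _ _ _ _ σ hK k m hm
  refine ⟨densityConst m k, ⟨densityConst_pos σ hK hm k, densityConst_le_one σ hK hm k⟩, ?_⟩
  intro z θ x hz hθ hx
  refine ⟨?_, shiftedEulerSum_estimate σ hK k hm hz hθ (by linarith)⟩
  refine (count_disc_le σ hK hm (R := x) (by linarith)).1.subset fun a ha => ?_
  have ha2 := ha.2
  rw [truncatedSector_eq_angularSector hz] at ha2
  refine ⟨ha.1, ?_, norm_le_of_mem_angularSector ha2⟩
  rintro rfl
  exact ne_zero_of_mem_angularSector ha2 (by simp)
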